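/- Let $N\in\mathbb N$, let $\Omega\subseteq\mathbb R^N$, and let $(\Omega,\Sigma,\mu)$ be a $\sigma$-finite measure space such that $\Sigma$ contains all relatively open subsets of $\Omega$. Measurable means $\Sigma$-measurable, scalars are real or complex, and $\mathcal M^+$ is the set of measurable functions $\Omega\to[0,\infty]$. A map $\eta:\mathcal M^+\to[0,\infty]$ is a function norm if for all $f,g,f_n\in\mathcal M^+$ and all measurable $E\subseteq\Omega$: (P1) $\eta(f)=0\iff f=0$ $\mu$-a.e.; $\eta(cf)=c\,\eta(f)$ for real $c\ge 0$; $\eta(f+g)\le\eta(f)+\eta(g)$; (P2) if $f\le g$ $\mu$-a.e., then $\eta(f)\le\eta(g)$; (P3) if $f_n\uparrow f$ $\mu$-a.e., then $\eta(f_n)\uparrow\eta(f)$; (P4) if $\mu(E)<\infty$, then $\eta(\chi_E)<\infty$; (P5) if $\mu(E)<\infty$, then there is a finite constant $C_E>0$ such that $\int_E f\,d\mu\le C_E\,\eta(f)$ for all $f\in\mathcal M^+$. A space $X$ of measurable scalar functions on $\Omega$ with a functional $\|\cdot\|$ is a Banach function space if there is a function norm $\eta$ such that $X=\{f \text{ measurable}:\eta(|f|)<\infty\}$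 and $\|f\|=\eta(|f|)$ for $f\in X$. For measurable $f$ put $f^*(s)=\inf\{\alpha\ge 0:\mu(\{|f|>\alpha\})\le s\}$ (with $\inf\emptyset=\infty$) and $f^{**}(s)=\frac1s\int_0^s f^*(t)\,dt$, and for $1<p,r<\infty$ let $$\|f\|_{L^{p,r}}=\Big(\int_0^\infty \big(t^{1/p}f^*(t)\big)^r\,\frac{dt}{t}\Big)^{1/r},\qquad \|f\|^*_{L^{p,r}}=\Big(\int_0^\infty \big(t^{1/p}f^{**}(t)\big)^r\,\frac{dt}{t}\Big)^{1/r}.$$ Let $A_{-1}=\{x\in\Omega:|x|<\tfrac12\}$ and $A_u=\{x\in\Omega:2^{u-1}\le|x|<2^u\}$ for integers $u\ge 0$. For $a\in\mathbb R$ and $1<p,q,r<\infty$ let $$\|f\|_{HL^{a,r}_{p,q}}=\Big(\sum_{u\ge -1}2^{uaq}\,\|f\chi_{A_u}\|_{L^{p,r}}^q\Big)^{1/q},\qquad \|f\|^*_{HL^{a,r}_{p,q}}=\Big(\sum_{u\ge -1}2^{uaq}\,\big(\|f\chi_{A_u}\|^*_{L^{p,r}}\big)^q\Big)^{1/q},$$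 and let $HL^{a,r}_{p,q}$ be the set of all measurable scalar functions $f$ on $\Omega$ such that $\|f\chi_K\|_{L^{p,r}}<\infty$ for every compact $K\subseteq\Omega$ and $\|f\|_{HL^{a,r}_{p,q}}<\infty$. **Theorem.** Let $a\in\mathbb R$ and $1<p,q,r<\infty$, and let $p'=\frac p{p-1}$ and $q'=\frac q{q-1}$. Then $\big(HL^{a,r}_{p,q},\|\cdot\|^*_{HL^{a,r}_{p,q}}\big)$ is a Banach function space if and only if, for every measurable $E\subseteq\Omega$ with $\mu(E)<\infty$, both of the following conditions hold: (a) $\displaystyle\sum_{u\ge -1}2^{uaq}\,\mu(A_u\cap E)^{q/p}<\infty$, (b) $\displaystyle\sum_{u\ge -1}2^{-uaq'}\,\mu(A_u\cap E)^{q'/p'}<\infty$. -/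

import Mathlib

open MeasureTheory Filter Topology Set
open scoped ENNReal NNReal

noncomputable section

namespace LorentzHerz

/-! ### Function norms and Banach function spaces -/

section BanachFunctionSpace

variable {α : Type*} [MeasurableSpace α]

/-- A (Banach) function norm `η : 𝓜⁺ → [0, ∞]`, where `𝓜⁺` is the cone of measurable functions with
values in `[0, ∞]`. The values of `η` at non-measurable functions are irrelevant. -/
structure IsFunctionNorm (μ : Measure α) (η : (α → ℝ≥0∞) → ℝ≥0∞) : Prop where
  eq_zero_iff : ∀ f, Measurable f → (η f = 0 ↔ f =ᵐ[μ] 0)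
  smul : ∀ (c : ℝ≥0) f, Measurable f → η (fun x => (c : ℝ≥0∞) * f x) = c * η f
  add_le : ∀ f g, Measurable f → Measurable g → η (fun x => f x + g x) ≤ η f + η g
  mono : ∀ f g, Measurable f → Measurable g → (∀ᵐ x ∂μ, f x ≤ g x) → η f ≤ η g
  /-- The Fatou property: `0 ≤ fₙ ↑ f` a.e. implies `η fₙ ↑ η f`. -/
  fatou : ∀ (f : ℕ → α → ℝ≥0∞) (g : α → ℝ≥0∞), (∀ n, Measurable (f n)) → Measurable g →
    (∀ᵐ x ∂μ, Monotone (fun n => f n x) ∧ Tendsto (fun n => f n x) atTop (𝓝 (g x))) →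
    Monotone (fun n => η (f n)) ∧ Tendsto (fun n => η (f n)) atTop (𝓝 (η g))
  indicator_lt_top : ∀ E, MeasurableSet E → μ E < ∞ → η (E.indicator 1) < ∞
  setLIntegral_le : ∀ E, MeasurableSet E → μ E < ∞ →
    ∃ C : ℝ≥0, 0 < C ∧ ∀ f, Measurable f → ∫⁻ x in E, f x ∂μ ≤ C * η f

/-- A set `X` of scalar functions with a functional `ν` on it is a Banach function space if there
is a function norm `η` with `X = {f measurable : η |f| < ∞}` and `ν f = η |f|` for `f ∈ X`. -/
def IsBanachFunctionSpace {𝕜 : Type*} [RCLike 𝕜] (μ : Measure α)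
    (X : Set (α → 𝕜)) (ν : (α → 𝕜) → ℝ≥0∞) : Prop :=
  ∃ η : (α → ℝ≥0∞) → ℝ≥0∞, IsFunctionNorm μ η ∧
    X = {f | Measurable f ∧ η (fun x => ‖f x‖ₑ) < ∞} ∧
    ∀ f ∈ X, ν f = η (fun x => ‖f x‖ₑ)

end BanachFunctionSpace

/-! ### Lorentz functionals -/

section Lorentz

variable {α : Type*} [MeasurableSpace α] {ε : Type*} [ENorm ε]

/-- The distribution function `μ_f(β) = μ {x : |f x| > β}`, `β ≥ 0`. -/
def distribution (μ : Measure α) (f : α → ε) (β : ℝ≥0) : ℝ≥0∞ :=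
  μ {x | (β : ℝ≥0∞) < ‖f x‖ₑ}

/-- The non-increasing rearrangement `f*(s) = inf {β ≥ 0 : μ_f(β) ≤ s}` (with `inf ∅ = ∞`), to be
used for `s ≥ 0`. -/
def rearrangement (μ : Measure α) (f : α → ε) (s : ℝ) : ℝ≥0∞ :=
  ⨅ (β : ℝ≥0) (_ : distribution μ f β ≤ ENNReal.ofReal s), (β : ℝ≥0∞)

/-- The average function `f**(s) = (1/s) ∫₀ˢ f*(t) dt`, to be used for `s > 0`. -/
def average (μ : Measure α) (f : α → ε) (s : ℝ) : ℝ≥0∞ :=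
  (∫⁻ t in Ioc 0 s, rearrangement μ f t) / ENNReal.ofReal s

/-- `(∫₀^∞ (t^{1/p} φ(t))^r dt/t)^{1/r}` for `φ : (0, ∞) → [0, ∞]` and `0 < p, r < ∞`. -/
def lorentzIntegral (p r : ℝ) (φ : ℝ → ℝ≥0∞) : ℝ≥0∞ :=
  (∫⁻ t in Ioi (0 : ℝ), (ENNReal.ofReal (t ^ (1 / p)) * φ t) ^ r / ENNReal.ofReal t) ^ (1 / r)

/-- The Lorentz quasi-norm `‖f‖_{L^{p,r}}`, built from `f*`. -/
def lorentzQuasinorm (μ : Measure α) (p r : ℝ) (f : α → ε) : ℝ≥0∞ :=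
  lorentzIntegral p r (rearrangement μ f)

/-- The functional `‖f‖*_{L^{p,r}}`, built from `f**`. -/
def lorentzNorm (μ : Measure α) (p r : ℝ) (f : α → ε) : ℝ≥0∞ :=
  lorentzIntegral p r (average μ f)

/-- The Lorentz space `L^{p,r}`. -/
def lorentzSpace (𝕜 : Type*) [RCLike 𝕜] (μ : Measure α) (p r : ℝ) : Set (α → 𝕜) :=
  {f | Measurable f ∧ lorentzQuasinorm μ p r f < ∞}

end Lorentz

/-! ### Lorentz-Herz spaces -/

section Herz

variable {N : ℕ}

/-- The sets `A_u`, `u ≥ -1`: `A_{-1} = {x ∈ Ω : |x| < 1/2}` and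
`A_u = {x ∈ Ω : 2^{u-1} ≤ |x| < 2^u}` for `u ≥ 0`. -/
def shell (Ω : Set (EuclideanSpace ℝ (Fin N))) (u : ℤ) : Set Ω :=
  if u = -1 then {x | ‖(x : EuclideanSpace ℝ (Fin N))‖ < 1 / 2}
  else {x | (2 : ℝ) ^ (u - 1) ≤ ‖(x : EuclideanSpace ℝ (Fin N))‖ ∧
    ‖(x : EuclideanSpace ℝ (Fin N))‖ < (2 : ℝ) ^ u}

variable {Ω : Set (EuclideanSpace ℝ (Fin N))} [MeasurableSpace Ω]

/-- `L^{p,r}_loc(Ω)`: measurable `f` with `f χ_K ∈ L^{p,r}` for every compact `K ⊆ Ω`. -/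
def lorentzLocSpace (𝕜 : Type*) [RCLike 𝕜] (μ : Measure Ω) (p r : ℝ) : Set (Ω → 𝕜) :=
  {f | Measurable f ∧ ∀ K : Set Ω, IsCompact K → K.indicator f ∈ lorentzSpace 𝕜 μ p r}

/-- `‖f‖_{HL^{a,r}_{p,q}} = (∑_{u ≥ -1} 2^{uaq} ‖f χ_{A_u}‖_{L^{p,r}}^q)^{1/q}`, `0 < q < ∞`. -/
def herzQuasinorm {ε : Type*} [ENorm ε] [Zero ε] (μ : Measure Ω) (a p q r : ℝ) (f : Ω → ε) :
    ℝ≥0∞ :=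
  (∑' u : Ici (-1 : ℤ), (2 : ℝ≥0∞) ^ (((u : ℤ) : ℝ) * a * q) *
    lorentzQuasinorm μ p r ((shell Ω u).indicator f) ^ q) ^ (1 / q)

/-- `‖f‖*_{HL^{a,r}_{p,q}} = (∑_{u ≥ -1} 2^{uaq} ‖f χ_{A_u}‖*_{L^{p,r}}^q)^{1/q}`, `0 < q < ∞`. -/
def herzNorm {ε : Type*} [ENorm ε] [Zero ε] (μ : Measure Ω) (a p q r : ℝ) (f : Ω → ε) : ℝ≥0∞ :=
  (∑' u : Ici (-1 : ℤ), (2 : ℝ≥0∞) ^ (((u : ℤ) : ℝ) * a * q) *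
    lorentzNorm μ p r ((shell Ω u).indicator f) ^ q) ^ (1 / q)

/-- The Lorentz-Herz space `HL^{a,r}_{p,q}(Ω)`. -/
def herzSpace (𝕜 : Type*) [RCLike 𝕜] (μ : Measure Ω) (a p q r : ℝ) : Set (Ω → 𝕜) :=
  {f | f ∈ lorentzLocSpace 𝕜 μ p r ∧ herzQuasinorm μ a p q r f < ∞}

end Herz

end LorentzHerz

end

/-! Since `f*` is decreasing, `f* ≤ f**`, and Hardy's inequality
(`exists_lorentzIntegral_average_le`) gives the converse estimate up to a constant. The starred and
unstarred functionals are therefore equivalent and define the same space. A compact set meets only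
finitely many shells, so the local condition is automatic (`mem_herzSpace_iff`): the Herz space is
exactly where the starred functional of `|f|` is finite.

The starred functional always satisfies (P1)-(P3). The triangle inequality comes from subadditivity
of `f ↦ ∫₀ˢ f*` (`setLIntegral_rearrangement_add_le`) and Minkowski in `L^r` and `ℓ^q`. The Fatou
property holds because rearrangement commutes with increasing suprema.

Only (P4) and (P5) depend on the measure. As `‖χ_F‖_{L^{p,r}}` is a constant times `μ(F)^{1/p}`,
(P4) amounts to (a). Condition (b) says that the weights `2^{-ua} μ(A_u ∩ E)^{1/p'}` lie in
`ℓ^{q'}`. It yields (P5) through the estimate `∫_F f ≤ C μ(F)^{1/p'} ‖f‖*` on each shell and Hölder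
over the shells. Conversely, testing (P5) on functions constant on each `A_u ∩ E` gives (b) by `ℓ^q`
duality (`sum_rpow_conj_le_of_sum_mul_le`). For necessity, an abstract `η` is known only on moduli
of members of the space, so every test function must first be shown to belong to it. -/

namespace LorentzHerz

/-! ### Rearrangements and their averages. -/

section Rearrangement

variable {α : Type*} [MeasurableSpace α] {μ : Measure α} {f g : α → ℝ≥0∞}

theorem rearrangement_enorm {ε : Type*} [ENorm ε] (f : α → ε) :
    rearrangement μ (fun x => ‖f x‖ₑ) = rearrangement μ f := by
  ext s
  simp [rearrangement, distribution]

theorem distribution_antitone (f : α → ℝ≥0∞) : Antitone (distribution μ f) := by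
  intro b c h
  refine measure_mono fun x hx => ?_
  exact lt_of_le_of_lt (ENNReal.coe_le_coe.2 h) hx

/-- The infimum defining `f*` is attained: the distribution function is right-continuous, because
`{|f| > b}` is the increasing union of the sets `{|f| > b + 1/(n+1)}`. Most facts about `f*` below
reduce to this equivalence. -/
theorem rearrangement_le_iff {s : ℝ} {b : ℝ≥0} :
    rearrangement μ f s ≤ b ↔ distribution μ f b ≤ ENNReal.ofReal s := by
  refine ⟨fun h => ?_, fun h => iInf₂_le b h⟩
  have key : ∀ n : ℕ, distribution μ f (b + 1 / (n + 1)) ≤ ENNReal.ofReal s := by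
    intro n
    have hlt : rearrangement μ f s < ((b + 1 / (n + 1) : ℝ≥0) : ℝ≥0∞) := by
      refine lt_of_le_of_lt h (ENNReal.coe_lt_coe.2 ?_)
      exact lt_add_of_pos_right _ (by positivity)
    simp only [rearrangement, iInf_lt_iff] at hlt
    obtain ⟨c, hc, hcb⟩ := hlt
    exact (distribution_antitone f (ENNReal.coe_lt_coe.1 hcb).le).trans hc
  have hU : {x | (b : ℝ≥0∞) < ‖f x‖ₑ} =
      ⋃ n : ℕ, {x | ((b + 1 / (n + 1) : ℝ≥0) : ℝ≥0∞) < ‖f x‖ₑ} := by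
    ext x
    simp only [mem_ofPred_eq, mem_iUnion]
    constructor
    · intro hx
      obtain ⟨c, hbc, hcx⟩ := ENNReal.lt_iff_exists_nnreal_btwn.1 hx
      have hbc' : b < c := ENNReal.coe_lt_coe.1 hbc
      obtain ⟨n, hn⟩ := exists_nat_one_div_lt (tsub_pos_of_lt hbc')
      refine ⟨n, lt_of_le_of_lt (ENNReal.coe_le_coe.2 ?_) hcx⟩
      calc b + 1 / (n + 1) ≤ b + (c - b) := by gcongr
        _ = c := add_tsub_cancel_of_le hbc'.le
    · rintro ⟨n, hn⟩
      refine lt_of_le_of_lt (ENNReal.coe_le_coe.2 ?_) hn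
      exact le_self_add
  have hmono : Monotone fun n : ℕ => {x | ((b + 1 / (n + 1) : ℝ≥0) : ℝ≥0∞) < ‖f x‖ₑ} := by
    intro m n hmn x hx
    refine lt_of_le_of_lt (ENNReal.coe_le_coe.2 ?_) hx
    gcongr
  rw [distribution, hU, hmono.measure_iUnion]
  exact iSup_le key

theorem lt_rearrangement_iff {s : ℝ} {b : ℝ≥0} :
    (b : ℝ≥0∞) < rearrangement μ f s ↔ ENNReal.ofReal s < distribution μ f b := by
  rw [← not_le, ← not_le, rearrangement_le_iff]

theorem rearrangement_antitone (f : α → ℝ≥0∞) : Antitone (rearrangement μ f) := by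
  intro s t hst
  refine le_of_forall_lt fun c hc => ?_
  obtain ⟨b, hcb, hb⟩ := ENNReal.lt_iff_exists_nnreal_btwn.1 hc
  refine hcb.trans (lt_rearrangement_iff.2 ?_)
  exact lt_of_le_of_lt (ENNReal.ofReal_le_ofReal hst) (lt_rearrangement_iff.1 hb)

theorem measurable_rearrangement (f : α → ℝ≥0∞) : Measurable (rearrangement μ f) :=
  (rearrangement_antitone f).measurable

theorem rearrangement_mono_ae (h : ∀ᵐ x ∂μ, f x ≤ g x) (s : ℝ) :
    rearrangement μ f s ≤ rearrangement μ g s := by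
  refine le_of_forall_lt fun c hc => ?_
  obtain ⟨b, hcb, hb⟩ := ENNReal.lt_iff_exists_nnreal_btwn.1 hc
  refine hcb.trans (lt_rearrangement_iff.2 ((lt_rearrangement_iff.1 hb).trans_le ?_))
  refine measure_mono_ae ?_
  filter_upwards [h] with x hx hbx
  exact lt_of_lt_of_le hbx hx

theorem rearrangement_const_mul (c : ℝ≥0) (s : ℝ) :
    rearrangement μ (fun x => (c : ℝ≥0∞) * f x) s = c * rearrangement μ f s := by
  rcases eq_or_ne c 0 with rfl | hc
  · refine le_antisymm ?_ (by simp)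
    have := (rearrangement_le_iff (μ := μ) (f := fun x => ((0 : ℝ≥0) : ℝ≥0∞) * f x)
      (s := s) (b := 0)).2 (by simp [distribution])
    simpa using this
  · have hd : ∀ b : ℝ≥0, distribution μ (fun x => (c : ℝ≥0∞) * f x) b
        = distribution μ f (b / c) := by
      intro b
      unfold distribution
      congr 1
      ext x
      simp only [mem_ofPred_eq, enorm_eq_self]
      rw [ENNReal.coe_div hc, ENNReal.div_lt_iff (Or.inl (by simpa using hc)) (Or.inl (by simp)),
        mul_comm]
    have hc' : (c : ℝ≥0∞) ≠ 0 := by simpa using hc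
    refine eq_of_forall_ge_iff fun d => ?_
    induction d using ENNReal.recTopCoe with
    | top => simp
    | coe d =>
      rw [rearrangement_le_iff, hd, ← rearrangement_le_iff, ENNReal.coe_div hc,
        ENNReal.le_div_iff_mul_le (Or.inl hc') (Or.inl (by simp)), mul_comm]

theorem distribution_iSup {f : ℕ → α → ℝ≥0∞} (hf : Monotone f) (b : ℝ≥0) :
    distribution μ (fun x => ⨆ n, f n x) b = ⨆ n, distribution μ (f n) b := by
  have hU : {x | (b : ℝ≥0∞) < ‖⨆ n, f n x‖ₑ} = ⋃ n, {x | (b : ℝ≥0∞) < ‖f n x‖ₑ} := by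
    ext x
    simp [lt_iSup_iff]
  have hmono : Monotone fun n => {x | (b : ℝ≥0∞) < ‖f n x‖ₑ} :=
    fun m n hmn x hx => lt_of_lt_of_le hx (hf hmn x)
  simp only [distribution]
  rw [hU, hmono.measure_iUnion]

theorem rearrangement_iSup {f : ℕ → α → ℝ≥0∞} (hf : Monotone f) (s : ℝ) :
    rearrangement μ (fun x => ⨆ n, f n x) s = ⨆ n, rearrangement μ (f n) s := by
  refine eq_of_forall_ge_iff fun d => ?_
  induction d using ENNReal.recTopCoe with
  | top => simp
  | coe d => simp [rearrangement_le_iff, distribution_iSup hf]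

theorem volume_ofReal_lt_inter_Ioi (c : ℝ≥0∞) :
    volume ({t : ℝ | ENNReal.ofReal t < c} ∩ Ioi 0) = c := by
  induction c using ENNReal.recTopCoe with
  | top => simp
  | coe c =>
    have : {t : ℝ | ENNReal.ofReal t < c} ∩ Ioi 0 = Ioo 0 (c : ℝ) := by
      ext t
      simp only [mem_inter_iff, mem_ofPred_eq, mem_Ioi, mem_Ioo]
      constructor
      · rintro ⟨h1, h2⟩
        refine ⟨h2, ?_⟩
        rw [← ENNReal.ofReal_coe_nnreal] at h1
        exact (ENNReal.ofReal_lt_ofReal_iff_of_nonneg h2.le).1 h1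
      · rintro ⟨h1, h2⟩
        refine ⟨?_, h1⟩
        rw [← ENNReal.ofReal_coe_nnreal]
        exact (ENNReal.ofReal_lt_ofReal_iff_of_nonneg h1.le).2 h2
    rw [this]
    simp

/-- Layer-cake formula by Tonelli, for functions that may take the value `∞`. -/
theorem lintegral_eq_lintegral_measure_ofReal_lt [SFinite μ] (hf : Measurable f) :
    ∫⁻ x, f x ∂μ = ∫⁻ t in Ioi (0 : ℝ), μ {x | ENNReal.ofReal t < f x} := by
  have hv : ∀ c : ℝ≥0∞, c = ∫⁻ t in Ioi (0 : ℝ), {t : ℝ | ENNReal.ofReal t < c}.indicator 1 t := by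
    intro c
    have hm : MeasurableSet {t : ℝ | ENNReal.ofReal t < c} :=
      measurableSet_lt ENNReal.measurable_ofReal measurable_const
    rw [lintegral_indicator_one hm, Measure.restrict_apply hm, volume_ofReal_lt_inter_Ioi]
  have hms : MeasurableSet {z : α × ℝ | ENNReal.ofReal z.2 < f z.1} :=
    measurableSet_lt (ENNReal.measurable_ofReal.comp measurable_snd) (hf.comp measurable_fst)
  calc ∫⁻ x, f x ∂μ
      = ∫⁻ x, (∫⁻ t in Ioi (0 : ℝ), {t : ℝ | ENNReal.ofReal t < f x}.indicator 1 t) ∂μ :=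
        lintegral_congr fun x => hv (f x)
    _ = ∫⁻ t in Ioi (0 : ℝ), (∫⁻ x, {t : ℝ | ENNReal.ofReal t < f x}.indicator 1 t ∂μ) := by
        refine lintegral_lintegral_swap (f := fun x t =>
          {t : ℝ | ENNReal.ofReal t < f x}.indicator 1 t) ?_
        exact ((measurable_const (a := (1 : ℝ≥0∞))).indicator hms).aemeasurable
    _ = ∫⁻ t in Ioi (0 : ℝ), μ {x | ENNReal.ofReal t < f x} := by
        refine lintegral_congr fun t => ?_
        rw [← lintegral_indicator_one (measurableSet_lt measurable_const hf)]
        rfl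

theorem measure_lt_rearrangement (b : ℝ≥0) :
    volume.restrict (Ioi (0 : ℝ)) {s | (b : ℝ≥0∞) < rearrangement μ f s} = distribution μ f b := by
  have hm : MeasurableSet {s | (b : ℝ≥0∞) < rearrangement μ f s} :=
    measurableSet_lt measurable_const (measurable_rearrangement f)
  rw [Measure.restrict_apply hm]
  simp only [lt_rearrangement_iff]
  exact volume_ofReal_lt_inter_Ioi _

/-- `f` and `f*` are equimeasurable, and `{f - c > t} = {f > t + c}`; both sides then have the same
layers. -/
theorem lintegral_rearrangement_tsub [SFinite μ] (hf : Measurable f) (c : ℝ≥0) :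
    ∫⁻ s in Ioi (0 : ℝ), (rearrangement μ f s - c) = ∫⁻ x, (f x - c) ∂μ := by
  rw [lintegral_eq_lintegral_measure_ofReal_lt (f := fun x => f x - c) (hf.sub measurable_const),
    lintegral_eq_lintegral_measure_ofReal_lt (f := fun s => rearrangement μ f s - c)
      ((measurable_rearrangement f).sub measurable_const)]
  refine lintegral_congr fun t => ?_
  have h : ∀ y : ℝ≥0∞, ENNReal.ofReal t < y - c ↔ ((t.toNNReal + c : ℝ≥0) : ℝ≥0∞) < y := by
    intro y
    rw [lt_tsub_iff_right, ENNReal.coe_add]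
    rfl
  simp only [h]
  rw [measure_lt_rearrangement]
  rfl

theorem lintegral_rearrangement [SFinite μ] (hf : Measurable f) :
    ∫⁻ s in Ioi (0 : ℝ), rearrangement μ f s = ∫⁻ x, f x ∂μ := by
  simpa using lintegral_rearrangement_tsub (μ := μ) hf 0

/-- Together with the next lemma, this shows that `∫₀ˢ f*` is the minimum over `c` of `∫ (f - c)⁺ +
s c`, attained at `c = f*(s)` when that value is finite. -/
theorem setLIntegral_rearrangement_le [SFinite μ] (hf : Measurable f) {s : ℝ}
    (c : ℝ≥0) : ∫⁻ t in Ioc 0 s, rearrangement μ f t ≤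
      ∫⁻ x, (f x - c) ∂μ + ENNReal.ofReal s * c := by
  calc ∫⁻ t in Ioc 0 s, rearrangement μ f t
      ≤ ∫⁻ t in Ioc 0 s, ((rearrangement μ f t - c) + c) :=
        lintegral_mono fun t => le_tsub_add
    _ = (∫⁻ t in Ioc 0 s, (rearrangement μ f t - c)) + ENNReal.ofReal s * c := by
        rw [lintegral_add_right _ measurable_const, setLIntegral_const]
        simp [mul_comm]
    _ ≤ _ := by
        rw [← lintegral_rearrangement_tsub hf]
        gcongr ?_ + _
        exact lintegral_mono_set Ioc_subset_Ioi_self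

theorem lintegral_tsub_rearrangement_le [SFinite μ] (hf : Measurable f) {s : ℝ}
    {c : ℝ≥0} (hc : rearrangement μ f s = c) :
    ∫⁻ x, (f x - c) ∂μ + ENNReal.ofReal s * c ≤ ∫⁻ t in Ioc 0 s, rearrangement μ f t := by
  -- Beyond `s` the truncated difference vanishes, because `f* ≤ f*(s) = c` there.
  have h1 : ∫⁻ t in Ioi (0 : ℝ), (rearrangement μ f t - c) ≤
      ∫⁻ t in Ioc 0 s, (rearrangement μ f t - c) := by
    rw [← lintegral_indicator measurableSet_Ioi, ← lintegral_indicator measurableSet_Ioc]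
    refine lintegral_mono fun t => ?_
    by_cases ht : t ∈ Ioc 0 s
    · rw [indicator_of_mem ht, indicator_of_mem (mem_Ioi.2 ht.1)]
    · by_cases ht0 : 0 < t
      · have hst : s ≤ t := by
          by_contra h
          exact ht ⟨ht0, (not_le.1 h).le⟩
        have : rearrangement μ f t - c = 0 :=
          tsub_eq_zero_of_le (hc ▸ rearrangement_antitone f hst)
        rw [indicator_of_mem (mem_Ioi.2 ht0), this]
        exact zero_le
      · simp [ht0]
  rw [← lintegral_rearrangement_tsub hf]
  calc _ ≤ (∫⁻ t in Ioc 0 s, (rearrangement μ f t - c)) + ∫⁻ t in Ioc 0 s, (c : ℝ≥0∞) := by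
        rw [setLIntegral_const]
        refine add_le_add h1 ?_
        simp [mul_comm]
    _ = ∫⁻ t in Ioc 0 s, ((rearrangement μ f t - c) + c) := by
        rw [lintegral_add_right _ measurable_const]
    _ = _ := by
        refine setLIntegral_congr_fun measurableSet_Ioc fun t ht => ?_
        exact tsub_add_cancel_of_le (hc ▸ rearrangement_antitone f ht.2)

/-- Use the optimal levels `c = f*(s)` and `d = g*(s)` for the summands and the level `c + d` for
the sum; then `(x + y - (c + d))⁺ ≤ (x - c)⁺ + (y - d)⁺`. An infinite level makes the right-hand
side infinite. -/
theorem setLIntegral_rearrangement_add_le [SFinite μ] (hf : Measurable f) (hg : Measurable g)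
    {s : ℝ} (hs : 0 < s) : ∫⁻ t in Ioc 0 s, rearrangement μ (fun x => f x + g x) t ≤
      (∫⁻ t in Ioc 0 s, rearrangement μ f t) + ∫⁻ t in Ioc 0 s, rearrangement μ g t := by
  have htop : ∀ h : α → ℝ≥0∞, rearrangement μ h s = ∞ →
      ∫⁻ t in Ioc 0 s, rearrangement μ h t = ∞ := by
    intro h hh
    refine top_le_iff.1 ?_
    calc ∞ = ∫⁻ t in Ioc 0 s, ∞ := by
          rw [setLIntegral_const, ENNReal.top_mul]
          simpa using hs
      _ ≤ _ := setLIntegral_mono' measurableSet_Ioc fun t ht => by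
          rw [← hh]; exact rearrangement_antitone h ht.2
  by_cases h1 : rearrangement μ f s = ∞
  · simp [htop f h1]
  by_cases h2 : rearrangement μ g s = ∞
  · rw [htop g h2, add_top]; exact le_top
  lift rearrangement μ f s to ℝ≥0 using h1 with c hc
  lift rearrangement μ g s to ℝ≥0 using h2 with d hd
  refine le_trans ?_ (add_le_add (lintegral_tsub_rearrangement_le hf hc.symm)
    (lintegral_tsub_rearrangement_le hg hd.symm))
  refine (setLIntegral_rearrangement_le (hf.add hg) (c + d)).trans ?_
  have : ∫⁻ x, (f x + g x - (c + d : ℝ≥0)) ∂μ ≤ ∫⁻ x, (f x - c) ∂μ + ∫⁻ x, (g x - d) ∂μ := by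
    rw [← lintegral_add_left (f := fun x => f x - c) (hf.sub measurable_const)]
    refine lintegral_mono fun x => ?_
    rw [ENNReal.coe_add]
    exact add_tsub_add_le_tsub_add_tsub
  calc _ ≤ ∫⁻ x, (f x - c) ∂μ + ∫⁻ x, (g x - d) ∂μ + ENNReal.ofReal s * (c + d : ℝ≥0) := by
        gcongr; exact this
    _ = _ := by rw [ENNReal.coe_add]; ring

theorem measurable_average (f : α → ℝ≥0∞) : Measurable (average μ f) := by
  refine Measurable.div ?_ ENNReal.measurable_ofReal
  refine Monotone.measurable fun s t hst => ?_
  exact lintegral_mono_set (Ioc_subset_Ioc_right hst)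

theorem average_mono_ae (h : ∀ᵐ x ∂μ, f x ≤ g x) (s : ℝ) : average μ f s ≤ average μ g s := by
  unfold average
  gcongr with t
  exact rearrangement_mono_ae h t

theorem average_const_mul (c : ℝ≥0) (s : ℝ) :
    average μ (fun x => (c : ℝ≥0∞) * f x) s = c * average μ f s := by
  simp only [average, rearrangement_const_mul]
  rw [lintegral_const_mul _ (measurable_rearrangement f), mul_div_assoc]

theorem average_add_le [SFinite μ] (hf : Measurable f) (hg : Measurable g) {s : ℝ} (hs : 0 < s) :
    average μ (fun x => f x + g x) s ≤ average μ f s + average μ g s := by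
  unfold average
  rw [← ENNReal.add_div]
  gcongr
  exact setLIntegral_rearrangement_add_le hf hg hs

theorem average_iSup {f : ℕ → α → ℝ≥0∞} (hf : Monotone f) (s : ℝ) :
    average μ (fun x => ⨆ n, f n x) s = ⨆ n, average μ (f n) s := by
  simp only [average, rearrangement_iSup hf]
  rw [lintegral_iSup (fun n => measurable_rearrangement (f n)), ENNReal.iSup_div]
  exact fun m n hmn t => rearrangement_mono_ae (ae_of_all _ (hf hmn)) t

theorem rearrangement_le_average (f : α → ℝ≥0∞) {s : ℝ} (hs : 0 < s) :
    rearrangement μ f s ≤ average μ f s := by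
  unfold average
  rw [ENNReal.le_div_iff_mul_le (Or.inl (by simpa using hs)) (Or.inl (by simp))]
  calc _ = ∫⁻ t in Ioc 0 s, rearrangement μ f s := by
        rw [setLIntegral_const]; simp
    _ ≤ _ := setLIntegral_mono' measurableSet_Ioc fun t ht => rearrangement_antitone f ht.2

theorem setLIntegral_le_setLIntegral_rearrangement [SFinite μ] (hf : Measurable f) {E : Set α}
    (hE : MeasurableSet E) {m : ℝ} (hm : μ E = ENNReal.ofReal m) :
    ∫⁻ x in E, f x ∂μ ≤ ∫⁻ t in Ioc 0 m, rearrangement μ f t := by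
  rw [← lintegral_indicator hE, ← lintegral_rearrangement (μ := μ) (hf.indicator hE)]
  -- The support of `f χ_E` has measure at most `m`, so its rearrangement lives on `(0, m)`.
  have h0 : ∀ t, m ≤ t → rearrangement μ (E.indicator f) t = 0 := by
    intro t ht
    refine le_antisymm ?_ zero_le
    refine (rearrangement_le_iff (b := 0)).2 ?_
    refine le_trans ?_ (hm.le.trans (ENNReal.ofReal_le_ofReal ht))
    refine measure_mono fun x hx => ?_
    by_contra hxE
    simp [hxE] at hx
  rw [← lintegral_indicator measurableSet_Ioi, ← lintegral_indicator measurableSet_Ioc]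
  refine lintegral_mono fun t => ?_
  by_cases ht : t ∈ Ioc 0 m
  · simp only [ht, indicator_of_mem, mem_Ioi, ht.1]
    exact rearrangement_mono_ae (ae_of_all _ fun x => indicator_le_self E f x) t
  · by_cases ht0 : 0 < t
    · have hst : m ≤ t := by
        by_contra h
        exact ht ⟨ht0, (not_le.1 h).le⟩
      rw [indicator_of_mem (mem_Ioi.2 ht0), h0 t hst]
      exact zero_le
    · simp [ht0]

theorem rearrangement_indicator_one {F : Set α} {s : ℝ} :
    rearrangement μ (F.indicator (1 : α → ℝ≥0∞)) s = if ENNReal.ofReal s < μ F then 1 else 0 := by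
  have hd : ∀ b : ℝ≥0, distribution μ (F.indicator (1 : α → ℝ≥0∞)) b = if b < 1 then μ F else 0 := by
    intro b
    unfold distribution
    split_ifs with hb
    · congr 1
      ext x
      by_cases hx : x ∈ F <;> simp [hx, hb]
    · convert measure_empty (μ := μ)
      ext x
      by_cases hx : x ∈ F <;> simp [hx, not_lt.1 hb]
  refine eq_of_forall_ge_iff fun d => ?_
  induction d using ENNReal.recTopCoe with
  | top => simp
  | coe d =>
    rw [rearrangement_le_iff, hd]
    by_cases h1 : d < 1 <;> by_cases h2 : ENNReal.ofReal s < μ F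
    · simp [h1, h2, not_le.2 h2]
    · rw [if_pos h1, if_neg h2]
      simp [not_lt.1 h2]
    · simp [h1, h2, not_lt.1 h1]
    · simp [h1, h2]

end Rearrangement

/-! ### Integrals of powers and Tonelli on a triangle. -/

section PowerIntegrals

theorem setLIntegral_Ioc_rpow {b m : ℝ} (hb : -1 < b) (hm : 0 ≤ m) :
    ∫⁻ t in Ioc 0 m, ENNReal.ofReal (t ^ b) = ENNReal.ofReal (m ^ (b + 1) / (b + 1)) := by
  have hi := intervalIntegral.intervalIntegrable_rpow' (a := 0) (b := m) hb
  rw [intervalIntegrable_iff_integrableOn_Ioc_of_le hm] at hi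
  rw [← ofReal_integral_eq_lintegral_ofReal hi, ← intervalIntegral.integral_of_le hm,
    integral_rpow (Or.inl hb), Real.zero_rpow (by linarith), sub_zero]
  refine (ae_restrict_iff' measurableSet_Ioc).2 (ae_of_all _ fun t ht => ?_)
  exact Real.rpow_nonneg ht.1.le _

theorem setLIntegral_Ioi_rpow {b m : ℝ} (hb : b < -1) (hm : 0 < m) :
    ∫⁻ t in Ioi m, ENNReal.ofReal (t ^ b) = ENNReal.ofReal (m ^ (b + 1) / -(b + 1)) := by
  rw [← ofReal_integral_eq_lintegral_ofReal (integrableOn_Ioi_rpow_of_lt hb hm),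
    integral_Ioi_rpow_of_lt hb hm, neg_div, div_neg]
  refine (ae_restrict_iff' measurableSet_Ioi).2 (ae_of_all _ fun t ht => ?_)
  exact Real.rpow_nonneg (hm.trans ht).le _

theorem lintegral_mul_setLIntegral_Ioc {u v : ℝ → ℝ≥0∞} (hu : Measurable u) (hv : Measurable v) :
    ∫⁻ s in Ioi (0 : ℝ), u s * ∫⁻ t in Ioc 0 s, v t =
      ∫⁻ t in Ioi (0 : ℝ), v t * ∫⁻ s in Ioi t, u s := by
  have hS : MeasurableSet {z : ℝ × ℝ | z.2 ≤ z.1} := measurableSet_le measurable_snd measurable_fst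
  have hm : Measurable ({z : ℝ × ℝ | z.2 ≤ z.1}.indicator fun z => u z.1 * v z.2) :=
    ((hu.comp measurable_fst).mul (hv.comp measurable_snd)).indicator hS
  calc ∫⁻ s in Ioi (0 : ℝ), u s * ∫⁻ t in Ioc 0 s, v t
      = ∫⁻ s in Ioi (0 : ℝ), ∫⁻ t in Ioi (0 : ℝ),
          {z : ℝ × ℝ | z.2 ≤ z.1}.indicator (fun z => u z.1 * v z.2) (s, t) := by
        refine lintegral_congr fun s => ?_
        rw [← lintegral_const_mul _ hv, ← lintegral_indicator measurableSet_Ioc,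
          ← lintegral_indicator measurableSet_Ioi]
        refine lintegral_congr fun t => ?_
        by_cases h1 : 0 < t <;> by_cases h2 : t ≤ s <;> simp [indicator, h1, h2]
    _ = ∫⁻ t in Ioi (0 : ℝ), ∫⁻ s in Ioi (0 : ℝ),
          {z : ℝ × ℝ | z.2 ≤ z.1}.indicator (fun z => u z.1 * v z.2) (s, t) :=
        lintegral_lintegral_swap hm.aemeasurable
    _ = _ := by
        refine setLIntegral_congr_fun measurableSet_Ioi fun t ht => ?_
        rw [← lintegral_const_mul _ hu, setLIntegral_congr (Ioi_ae_eq_Ici (a := t) (μ := volume)),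
          ← lintegral_indicator measurableSet_Ici, ← lintegral_indicator measurableSet_Ioi]
        refine lintegral_congr fun s => ?_
        have ht' : 0 < t := ht
        by_cases h2 : t ≤ s
        · simp [indicator, h2, ht'.trans_le h2, mul_comm]
        · simp [indicator, h2]

end PowerIntegrals

/-! ### The weighted `L^r` functional on the half-line and Hardy's inequality. -/

section LorentzIntegral

variable {p r : ℝ} {φ ψ : ℝ → ℝ≥0∞}

/-- Absorbing `dt/t` into the power turns the functional into an ordinary `L^r` norm of `t^{1/p -
1/r} φ`, to which Minkowski applies. -/
theorem lorentzIntegral_eq (hr : 0 < r) (p : ℝ) (φ : ℝ → ℝ≥0∞) :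
    lorentzIntegral p r φ =
      (∫⁻ t in Ioi (0 : ℝ), (ENNReal.ofReal (t ^ (1 / p - 1 / r)) * φ t) ^ r) ^ (1 / r) := by
  unfold lorentzIntegral
  congr 1
  refine setLIntegral_congr_fun measurableSet_Ioi fun t ht => ?_
  have ht' : 0 < t := ht
  have h1 : ENNReal.ofReal t ^ (-1 : ℝ) = (ENNReal.ofReal (t ^ (-(1 / r)))) ^ r := by
    rw [ENNReal.ofReal_rpow_of_pos ht', ENNReal.ofReal_rpow_of_pos (by positivity),
      ← Real.rpow_mul ht'.le]
    congr 2
    field_simp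
  rw [div_eq_mul_inv, ← ENNReal.rpow_neg_one, h1, ← ENNReal.mul_rpow_of_nonneg _ _ hr.le,
    sub_eq_add_neg, Real.rpow_add ht', ENNReal.ofReal_mul (by positivity)]
  congr 1
  ring

theorem lorentzIntegral_mono (hr : 0 ≤ r) (h : ∀ t, 0 < t → φ t ≤ ψ t) :
    lorentzIntegral p r φ ≤ lorentzIntegral p r ψ := by
  unfold lorentzIntegral
  refine ENNReal.rpow_le_rpow (setLIntegral_mono' measurableSet_Ioi fun t ht => ?_) (by positivity)
  gcongr
  exact h t ht

theorem measurable_ofReal_rpow (b : ℝ) : Measurable fun t : ℝ => ENNReal.ofReal (t ^ b) :=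
  (measurable_id.pow_const b).ennreal_ofReal

theorem measurable_ofReal_rpow_mul (b : ℝ) (hφ : Measurable φ) :
    Measurable fun t : ℝ => ENNReal.ofReal (t ^ b) * φ t :=
  (measurable_ofReal_rpow b).mul hφ

theorem lorentzIntegral_const_mul (hr : 0 < r) (hφ : Measurable φ) (c : ℝ≥0∞) :
    lorentzIntegral p r (fun t => c * φ t) = c * lorentzIntegral p r φ := by
  rw [lorentzIntegral_eq hr, lorentzIntegral_eq hr]
  have h : ∀ t, (ENNReal.ofReal (t ^ (1 / p - 1 / r)) * (c * φ t)) ^ r =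
      c ^ r * (ENNReal.ofReal (t ^ (1 / p - 1 / r)) * φ t) ^ r := by
    intro t
    rw [← ENNReal.mul_rpow_of_nonneg _ _ hr.le]
    congr 1
    ring
  simp only [h]
  rw [lintegral_const_mul _ ((measurable_ofReal_rpow_mul _ hφ).pow_const r),
    ENNReal.mul_rpow_of_nonneg _ _ (by positivity), ← ENNReal.rpow_mul,
    mul_one_div_cancel hr.ne', ENNReal.rpow_one]

theorem lorentzIntegral_add_le (hr : 1 ≤ r) (hφ : Measurable φ) (hψ : Measurable ψ) :
    lorentzIntegral p r (fun t => φ t + ψ t) ≤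
      lorentzIntegral p r φ + lorentzIntegral p r ψ := by
  have hr0 : 0 < r := by linarith
  simp only [lorentzIntegral_eq hr0, mul_add]
  exact ENNReal.lintegral_Lp_add_le (measurable_ofReal_rpow_mul _ hφ).aemeasurable
    (measurable_ofReal_rpow_mul _ hψ).aemeasurable hr

theorem lorentzIntegral_iSup (hr : 0 < r) {φ : ℕ → ℝ → ℝ≥0∞} (hφ : ∀ n, Measurable (φ n))
    (hmono : Monotone φ) : lorentzIntegral p r (fun t => ⨆ n, φ n t) =
      ⨆ n, lorentzIntegral p r (φ n) := by
  have h : ∀ t, (ENNReal.ofReal (t ^ (1 / p - 1 / r)) * ⨆ n, φ n t) ^ r =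
      ⨆ n, (ENNReal.ofReal (t ^ (1 / p - 1 / r)) * φ n t) ^ r := by
    intro t
    rw [ENNReal.mul_iSup]
    exact (ENNReal.orderIsoRpow r hr).map_iSup _
  simp only [lorentzIntegral_eq hr, h]
  rw [lintegral_iSup (fun n => (measurable_ofReal_rpow_mul _ (hφ n)).pow_const r)]
  · exact (ENNReal.orderIsoRpow (1 / r) (by positivity)).map_iSup _
  · intro m n hmn t
    dsimp only
    gcongr
    exact hmono hmn t

/-- Hardy's inequality for the averaging operator. -/
theorem exists_lorentzIntegral_average_le (hp : 1 < p) (hr : 1 < r) :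
    ∃ C : ℝ≥0, ∀ φ : ℝ → ℝ≥0∞, Measurable φ →
      lorentzIntegral p r (fun s => (∫⁻ t in Ioc 0 s, φ t) / ENNReal.ofReal s) ≤
        C * lorentzIntegral p r φ := by
  have hr0 : 0 < r := by linarith
  have hp1 : 1 / p < 1 := by rw [div_lt_one (by linarith)]; exact hp
  -- The auxiliary exponent of Hardy's inequality: `b < 1/r'` makes `t^{-br'}` integrable at `0`,
  -- and `b > 1/p - 1/r` makes the outer power of `s` integrable at infinity after Tonelli. The
  -- window is nonempty because `p > 1`.
  obtain ⟨b, hb1, hb2⟩ := exists_between (show 1 / p - 1 / r < 1 - 1 / r by linarith)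
  set r' := r.conjExponent with hr'
  have hc : r.HolderConjugate r' := Real.HolderConjugate.conjExponent hr
  have hr'0 : 0 < r' := hc.symm.pos
  have hinv : 1 / r + 1 / r' = 1 := by simpa using hc.inv_add_inv_eq_one
  have hbr : b * r' < 1 := by
    have : b < 1 / r' := by linarith
    rwa [lt_div_iff₀ hr'0] at this
  set e := 1 / p - 1 / r with he
  set A : ℝ := (1 / (1 - b * r')) ^ (1 / r') with hA
  have hA0 : 0 ≤ A := Real.rpow_nonneg (by rw [one_div, inv_nonneg]; linarith) _
  set B : ℝ := 1 / (b * r - e * r) with hB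
  have hbe : 0 < b * r - e * r := by
    rw [← sub_mul]; exact mul_pos (by linarith) hr0
  have hB0 : 0 ≤ B := by positivity
  refine ⟨Real.toNNReal ((A ^ r * B) ^ (1 / r)), fun φ hφ => ?_⟩
  have hm := fun b => measurable_ofReal_rpow b
  -- Hölder applied to `φ = (t^b φ) · t^{-b}` on `(0, s]`; the second factor has `L^{r'}` norm `A
  -- s^{1/r' - b}`.
  have holder : ∀ s, 0 < s → (ENNReal.ofReal (s ^ e) *
      ((∫⁻ t in Ioc 0 s, φ t) / ENNReal.ofReal s)) ^ r ≤
      ENNReal.ofReal (A ^ r) * (ENNReal.ofReal (s ^ (e * r - 1 - b * r)) *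
        ∫⁻ t in Ioc 0 s, (ENNReal.ofReal (t ^ b) * φ t) ^ r) := by
    intro s hs
    have h1 : ∫⁻ t in Ioc 0 s, φ t ≤ (∫⁻ t in Ioc 0 s, (ENNReal.ofReal (t ^ b) * φ t) ^ r) ^ (1 / r)
        * ENNReal.ofReal (A * s ^ (1 / r' - b)) := by
      have h2 : ∫⁻ t in Ioc 0 s, φ t = ∫⁻ t in Ioc 0 s,
          ((fun t => ENNReal.ofReal (t ^ b) * φ t) * fun t => ENNReal.ofReal (t ^ (-b))) t := by
        refine setLIntegral_congr_fun measurableSet_Ioc fun t ht => ?_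
        rw [Pi.mul_apply, mul_right_comm, ← ENNReal.ofReal_mul (Real.rpow_nonneg ht.1.le _),
          ← Real.rpow_add ht.1]
        simp
      have h3 : (∫⁻ t in Ioc 0 s, ENNReal.ofReal (t ^ (-b)) ^ r') ^ (1 / r') =
          ENNReal.ofReal (A * s ^ (1 / r' - b)) := by
        have : ∫⁻ t in Ioc 0 s, ENNReal.ofReal (t ^ (-b)) ^ r' =
            ∫⁻ t in Ioc 0 s, ENNReal.ofReal (t ^ (-(b * r'))) := by
          refine setLIntegral_congr_fun measurableSet_Ioc fun t ht => ?_
          have ht0 : 0 < t := ht.1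
          rw [ENNReal.ofReal_rpow_of_pos (by positivity), ← Real.rpow_mul ht0.le, neg_mul]
        have h4 : 0 < -(b * r') + 1 := by linarith
        rw [this, setLIntegral_Ioc_rpow (by linarith) hs.le, ENNReal.ofReal_rpow_of_pos
          (by positivity)]
        congr 1
        rw [div_eq_mul_one_div, Real.mul_rpow (by positivity) (by positivity),
          ← Real.rpow_mul hs.le, mul_comm]
        congr 2
        · rw [neg_add_eq_sub]
        · field_simp; ring
      rw [h2, ← h3]
      exact ENNReal.lintegral_mul_le_Lp_mul_Lq _ hc (measurable_ofReal_rpow_mul b hφ).aemeasurable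
        (hm (-b)).aemeasurable
    set J := ∫⁻ t in Ioc 0 s, (ENNReal.ofReal (t ^ b) * φ t) ^ r
    have hs1 : (ENNReal.ofReal s)⁻¹ = ENNReal.ofReal (s ^ (-1 : ℝ)) := by
      rw [Real.rpow_neg_one, ENNReal.ofReal_inv_of_pos hs]
    calc (ENNReal.ofReal (s ^ e) * ((∫⁻ t in Ioc 0 s, φ t) / ENNReal.ofReal s)) ^ r
        ≤ (ENNReal.ofReal (s ^ e) * ((J ^ (1 / r) * ENNReal.ofReal (A * s ^ (1 / r' - b))) /
            ENNReal.ofReal s)) ^ r := by gcongr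
      _ = (ENNReal.ofReal (A * s ^ (e - 1 + 1 / r' - b)) * J ^ (1 / r)) ^ r := by
          congr 1
          rw [div_eq_mul_inv, hs1, show ENNReal.ofReal (s ^ e) *
            (J ^ (1 / r) * ENNReal.ofReal (A * s ^ (1 / r' - b)) * ENNReal.ofReal (s ^ (-1 : ℝ))) =
            (ENNReal.ofReal (A * s ^ (1 / r' - b)) * ENNReal.ofReal (s ^ e) *
              ENNReal.ofReal (s ^ (-1 : ℝ))) * J ^ (1 / r) by ring,
            ← ENNReal.ofReal_mul (by positivity), ← ENNReal.ofReal_mul (by positivity)]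
          congr 2
          rw [mul_assoc, mul_assoc, ← Real.rpow_add hs, ← Real.rpow_add hs]
          congr 2
          ring
      _ = ENNReal.ofReal (A ^ r) * (ENNReal.ofReal (s ^ (e * r - 1 - b * r)) * J) := by
          rw [ENNReal.mul_rpow_of_nonneg _ _ hr0.le, ← ENNReal.rpow_mul,
            one_div_mul_cancel hr0.ne', ENNReal.rpow_one, ENNReal.ofReal_rpow_of_nonneg
            (by positivity) hr0.le, Real.mul_rpow hA0 (by positivity), ← Real.rpow_mul hs.le,
            ENNReal.ofReal_mul (by positivity), mul_assoc]
          congr 4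
          rw [show 1 / r' = 1 - 1 / r by linarith]
          field_simp
          ring
  have hcomp : ∫⁻ s in Ioi (0 : ℝ), (ENNReal.ofReal (s ^ e) *
      ((∫⁻ t in Ioc 0 s, φ t) / ENNReal.ofReal s)) ^ r ≤
      ENNReal.ofReal (A ^ r * B) * ∫⁻ t in Ioi (0 : ℝ), (ENNReal.ofReal (t ^ e) * φ t) ^ r := by
    calc _ ≤ ∫⁻ s in Ioi (0 : ℝ), ENNReal.ofReal (A ^ r) *
          (ENNReal.ofReal (s ^ (e * r - 1 - b * r)) *
            ∫⁻ t in Ioc 0 s, (ENNReal.ofReal (t ^ b) * φ t) ^ r) :=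
          setLIntegral_mono' measurableSet_Ioi holder
      _ = ENNReal.ofReal (A ^ r) * ∫⁻ t in Ioi (0 : ℝ), (ENNReal.ofReal (t ^ b) * φ t) ^ r *
            ∫⁻ s in Ioi t, ENNReal.ofReal (s ^ (e * r - 1 - b * r)) := by
          rw [lintegral_const_mul' _ _ ENNReal.ofReal_ne_top, lintegral_mul_setLIntegral_Ioc (hm _)
            ((measurable_ofReal_rpow_mul b hφ).pow_const r)]
      -- The inner integral over `s > t` equals `B t^{(e-b)r}`, which converts the weight `t^{br}`
      -- back into `t^{er}`.
      _ = ENNReal.ofReal (A ^ r) * ∫⁻ t in Ioi (0 : ℝ), ENNReal.ofReal B *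
            (ENNReal.ofReal (t ^ e) * φ t) ^ r := by
          congr 1
          refine setLIntegral_congr_fun measurableSet_Ioi fun t ht => ?_
          have ht0 : 0 < t := ht
          rw [setLIntegral_Ioi_rpow (by linarith) ht0, ENNReal.mul_rpow_of_nonneg _ _ hr0.le,
            ENNReal.mul_rpow_of_nonneg _ _ hr0.le, mul_right_comm, ← mul_assoc]
          congr 1
          rw [ENNReal.ofReal_rpow_of_pos (by positivity), ENNReal.ofReal_rpow_of_pos
            (by positivity), ← ENNReal.ofReal_mul (by positivity), ← ENNReal.ofReal_mul hB0,
            ← Real.rpow_mul ht0.le, ← Real.rpow_mul ht0.le, ← mul_div_assoc, ← Real.rpow_add ht0,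
            hB, one_div_mul_eq_div]
          congr 3 <;> ring
      _ = _ := by
          rw [lintegral_const_mul' _ _ ENNReal.ofReal_ne_top, ← mul_assoc,
            ← ENNReal.ofReal_mul (by positivity)]
  rw [lorentzIntegral_eq hr0, lorentzIntegral_eq hr0]
  calc _ ≤ (ENNReal.ofReal (A ^ r * B) *
        ∫⁻ t in Ioi (0 : ℝ), (ENNReal.ofReal (t ^ e) * φ t) ^ r) ^ (1 / r) := by gcongr
    _ = _ := by
      rw [ENNReal.mul_rpow_of_nonneg _ _ (by positivity), ENNReal.ofReal_rpow_of_nonneg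
        (by positivity) (by positivity)]
      rfl

end LorentzIntegral

/-! ### The Lorentz functionals on functions. -/

section LorentzNorm

variable {α : Type*} [MeasurableSpace α] {μ : Measure α} {p r : ℝ} {f g : α → ℝ≥0∞}

theorem lorentzQuasinorm_enorm {ε : Type*} [ENorm ε] (f : α → ε) :
    lorentzQuasinorm μ p r (fun x => ‖f x‖ₑ) = lorentzQuasinorm μ p r f := by
  rw [lorentzQuasinorm, rearrangement_enorm, lorentzQuasinorm]

theorem lorentzNorm_enorm {ε : Type*} [ENorm ε] (f : α → ε) :
    lorentzNorm μ p r (fun x => ‖f x‖ₑ) = lorentzNorm μ p r f := by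
  have : average μ (fun x => ‖f x‖ₑ) = average μ f := by
    ext s
    rw [average, rearrangement_enorm, average]
  rw [lorentzNorm, this, lorentzNorm]

theorem lorentzNorm_mono_ae (hr : 0 ≤ r) (h : ∀ᵐ x ∂μ, f x ≤ g x) :
    lorentzNorm μ p r f ≤ lorentzNorm μ p r g :=
  lorentzIntegral_mono hr fun t _ => average_mono_ae h t

theorem lorentzNorm_const_mul (hr : 0 < r) (c : ℝ≥0) :
    lorentzNorm μ p r (fun x => (c : ℝ≥0∞) * f x) = c * lorentzNorm μ p r f := by
  have : average μ (fun x => (c : ℝ≥0∞) * f x) = fun s => c * average μ f s :=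
    funext fun s => average_const_mul c s
  rw [lorentzNorm, this, lorentzIntegral_const_mul hr (measurable_average f), lorentzNorm]

theorem lorentzQuasinorm_const_mul (hr : 0 < r) (c : ℝ≥0) :
    lorentzQuasinorm μ p r (fun x => (c : ℝ≥0∞) * f x) = c * lorentzQuasinorm μ p r f := by
  have : rearrangement μ (fun x => (c : ℝ≥0∞) * f x) = fun s => c * rearrangement μ f s :=
    funext fun s => rearrangement_const_mul c s
  rw [lorentzQuasinorm, this, lorentzIntegral_const_mul hr (measurable_rearrangement f),
    lorentzQuasinorm]

theorem lorentzNorm_zero (hr : 0 < r) : lorentzNorm μ p r (0 : α → ℝ≥0∞) = 0 := by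
  have h : (0 : α → ℝ≥0∞) = fun x => ((0 : ℝ≥0) : ℝ≥0∞) * (0 : α → ℝ≥0∞) x := by ext; simp
  rw [h, lorentzNorm_const_mul hr]
  simp

theorem lorentzNorm_add_le [SFinite μ] (hr : 1 ≤ r) (hf : Measurable f) (hg : Measurable g) :
    lorentzNorm μ p r (fun x => f x + g x) ≤ lorentzNorm μ p r f + lorentzNorm μ p r g :=
  (lorentzIntegral_mono (by linarith) fun _ ht => average_add_le hf hg ht).trans
    (lorentzIntegral_add_le hr (measurable_average f) (measurable_average g))

theorem lorentzNorm_sum_le [SFinite μ] {ι : Type*} (hr : 1 ≤ r) {f : ι → α → ℝ≥0∞}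
    (hf : ∀ i, Measurable (f i)) (s : Finset ι) :
    lorentzNorm μ p r (fun x => ∑ i ∈ s, f i x) ≤ ∑ i ∈ s, lorentzNorm μ p r (f i) := by
  classical
  induction s using Finset.induction_on with
  | empty =>
    simp only [Finset.sum_empty]
    exact (lorentzNorm_zero (by linarith)).le
  | insert i s hi ih =>
    simp only [Finset.sum_insert hi]
    exact (lorentzNorm_add_le hr (hf i) (Finset.measurable_sum s fun i _ => hf i)).trans
      (by gcongr)

theorem lorentzNorm_iSup (hr : 0 < r) {f : ℕ → α → ℝ≥0∞} (hf : Monotone f) :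
    lorentzNorm μ p r (fun x => ⨆ n, f n x) = ⨆ n, lorentzNorm μ p r (f n) := by
  have : average μ (fun x => ⨆ n, f n x) = fun s => ⨆ n, average μ (f n) s :=
    funext fun s => average_iSup hf s
  rw [lorentzNorm, this, lorentzIntegral_iSup hr (fun n => measurable_average (f n))]
  · rfl
  · exact fun m n hmn s => average_mono_ae (ae_of_all _ (hf hmn)) s

theorem lorentzQuasinorm_le_lorentzNorm (hr : 0 ≤ r) (f : α → ℝ≥0∞) :
    lorentzQuasinorm μ p r f ≤ lorentzNorm μ p r f :=
  lorentzIntegral_mono hr fun _ ht => rearrangement_le_average f ht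

theorem exists_lorentzNorm_le_lorentzQuasinorm (hp : 1 < p) (hr : 1 < r) (μ : Measure α) :
    ∃ C : ℝ≥0, ∀ f : α → ℝ≥0∞, lorentzNorm μ p r f ≤ C * lorentzQuasinorm μ p r f := by
  obtain ⟨C, hC⟩ := exists_lorentzIntegral_average_le hp hr
  exact ⟨C, fun f => hC _ (measurable_rearrangement f)⟩

/-- For `t > m` one has `f**(t) ≥ t⁻¹ ∫₀ᵐ f*`, so the tail `t > m` of the norm integral already
dominates. The constant comes from `∫_m^∞ t^{-K-1} dt = m^{-K}/K` with `K = r(1 - 1/p)`. -/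
theorem exists_setLIntegral_rearrangement_le_lorentzNorm (hp : 1 < p) (hr : 1 < r)
    (μ : Measure α) : ∃ C : ℝ≥0, ∀ (f : α → ℝ≥0∞) (m : ℝ), 0 < m →
      ∫⁻ t in Ioc 0 m, rearrangement μ f t ≤
        C * ENNReal.ofReal (m ^ (1 - 1 / p)) * lorentzNorm μ p r f := by
  have hr0 : 0 < r := by linarith
  have hp1 : 1 / p < 1 := by rw [div_lt_one (by linarith)]; exact hp
  set K : ℝ := r * (1 - 1 / p) with hK
  have hK0 : 0 < K := mul_pos hr0 (by linarith)
  refine ⟨(K ^ (1 / r)).toNNReal, fun f m hm => ?_⟩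
  set I := ∫⁻ t in Ioc 0 m, rearrangement μ f t with hI
  have h1 : I * ENNReal.ofReal ((K ^ (1 / r))⁻¹ * (m ^ (1 - 1 / p))⁻¹) ≤ lorentzNorm μ p r f := by
    rw [lorentzNorm, lorentzIntegral_eq hr0]
    calc I * ENNReal.ofReal ((K ^ (1 / r))⁻¹ * (m ^ (1 - 1 / p))⁻¹)
        = (I ^ r * ENNReal.ofReal (m ^ (-K) / K)) ^ (1 / r) := by
          rw [ENNReal.mul_rpow_of_nonneg _ _ (by positivity), ← ENNReal.rpow_mul,
            mul_one_div_cancel hr0.ne', ENNReal.rpow_one, ENNReal.ofReal_rpow_of_pos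
            (by positivity), Real.div_rpow (by positivity) hK0.le, ← Real.rpow_mul hm.le,
            show -K * (1 / r) = -(1 - 1 / p) by rw [hK]; field_simp, Real.rpow_neg hm.le]
          congr 2
          exact (div_eq_inv_mul _ _).symm
      _ = (∫⁻ t in Ioi m, I ^ r * ENNReal.ofReal (t ^ (-K - 1))) ^ (1 / r) := by
          rw [lintegral_const_mul _ (measurable_ofReal_rpow _),
            setLIntegral_Ioi_rpow (by linarith) hm, sub_add_cancel, neg_neg]
      _ ≤ (∫⁻ t in Ioi m, (ENNReal.ofReal (t ^ (1 / p - 1 / r)) * average μ f t) ^ r) ^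
            (1 / r) := by
          refine ENNReal.rpow_le_rpow (setLIntegral_mono' measurableSet_Ioi fun t ht => ?_)
            (by positivity)
          have ht0 : 0 < t := hm.trans ht
          have h2 : I ^ r * ENNReal.ofReal (t ^ (-K - 1)) =
              (ENNReal.ofReal (t ^ (1 / p - 1 / r)) * (I / ENNReal.ofReal t)) ^ r := by
            have h3 : I / ENNReal.ofReal t = I * ENNReal.ofReal t⁻¹ := by
              rw [ENNReal.ofReal_inv_of_pos ht0, div_eq_mul_inv]
            rw [h3, mul_left_comm, ENNReal.mul_rpow_of_nonneg _ _ hr0.le,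
              ← ENNReal.ofReal_mul (by positivity), ENNReal.ofReal_rpow_of_pos (by positivity), ← Real.rpow_neg_one,
              ← Real.rpow_add ht0, ← Real.rpow_mul ht0.le]
            congr 3
            rw [hK]; field_simp; ring
          rw [h2, average]
          gcongr
          exact lintegral_mono_set (Ioc_subset_Ioc_right ht.le)
      _ ≤ _ := by
          gcongr
  have hK1 : 0 < K ^ (1 / r) := Real.rpow_pos_of_pos hK0 _
  have hm1 : 0 < m ^ (1 - 1 / p) := Real.rpow_pos_of_pos hm _
  calc I = ENNReal.ofReal (K ^ (1 / r)) * ENNReal.ofReal (m ^ (1 - 1 / p)) *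
        (I * ENNReal.ofReal ((K ^ (1 / r))⁻¹ * (m ^ (1 - 1 / p))⁻¹)) := by
        rw [mul_left_comm, ← ENNReal.ofReal_mul hK1.le, ← ENNReal.ofReal_mul (by positivity)]
        rw [show K ^ (1 / r) * m ^ (1 - 1 / p) * ((K ^ (1 / r))⁻¹ * (m ^ (1 - 1 / p))⁻¹) = 1 by
          field_simp]
        simp
    _ ≤ _ := by
        gcongr
        exact le_rfl

theorem exists_setLIntegral_le_lorentzNorm [SFinite μ] (hp : 1 < p) (hr : 1 < r) :
    ∃ C : ℝ≥0, ∀ (f : α → ℝ≥0∞) (E : Set α), Measurable f → MeasurableSet E → μ E < ∞ →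
      ∫⁻ x in E, f x ∂μ ≤ C * μ E ^ (1 - 1 / p) * lorentzNorm μ p r f := by
  obtain ⟨C, hC⟩ := exists_setLIntegral_rearrangement_le_lorentzNorm hp hr μ
  refine ⟨C, fun f E hf hE hEt => ?_⟩
  by_cases h0 : μ E = 0
  · rw [Measure.restrict_eq_zero.2 h0]
    simp
  · have hm := ENNReal.toReal_pos h0 hEt.ne
    have hE' : μ E = ENNReal.ofReal (μ E).toReal := (ENNReal.ofReal_toReal hEt.ne).symm
    refine (setLIntegral_le_setLIntegral_rearrangement hf hE hE').trans ((hC f _ hm).trans ?_)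
    rw [← ENNReal.ofReal_rpow_of_pos hm, ← hE']

/-- A vanishing norm forces `∫₀ᵐ f* = 0` for every `m > 0`, hence `∫ f = ∫ f* = 0`. -/
theorem ae_eq_zero_of_lorentzNorm_eq_zero [SFinite μ] (hp : 1 < p) (hr : 1 < r)
    (hf : Measurable f) (h : lorentzNorm μ p r f = 0) : f =ᵐ[μ] 0 := by
  obtain ⟨C, hC⟩ := exists_setLIntegral_rearrangement_le_lorentzNorm hp hr μ
  rw [← lintegral_eq_zero_iff hf, ← lintegral_rearrangement hf]
  have hU : Ioi (0 : ℝ) = ⋃ n : ℕ, Ioc 0 ((n : ℝ) + 1) := by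
    ext t
    simp only [mem_Ioi, mem_iUnion, mem_Ioc]
    refine ⟨fun ht => ?_, fun ⟨_, h, _⟩ => h⟩
    obtain ⟨n, hn⟩ := exists_nat_ge t
    exact ⟨n, ht, by linarith⟩
  rw [hU]
  refine le_antisymm ((lintegral_iUnion_le _ _).trans ?_) zero_le
  refine le_of_eq (ENNReal.tsum_eq_zero.2 fun n => ?_)
  have := hC f (n + 1) (by positivity)
  rw [h, mul_zero] at this
  exact le_antisymm this zero_le

theorem lorentzQuasinorm_indicator_one (hp : 0 < p) (hr : 0 < r) {F : Set α} (hF : μ F ≠ ∞) :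
    lorentzQuasinorm μ p r (F.indicator (1 : α → ℝ≥0∞)) =
      ENNReal.ofReal ((p / r) ^ (1 / r)) * μ F ^ (1 / p) := by
  obtain ⟨m, hm⟩ : ∃ m : ℝ≥0, (m : ℝ≥0∞) = μ F := ⟨_, ENNReal.coe_toNNReal hF⟩
  rw [lorentzQuasinorm, lorentzIntegral_eq hr]
  have h1 : ∫⁻ t in Ioi (0 : ℝ), (ENNReal.ofReal (t ^ (1 / p - 1 / r)) *
      rearrangement μ (F.indicator (1 : α → ℝ≥0∞)) t) ^ r =
      ∫⁻ t in Ioc (0 : ℝ) m, ENNReal.ofReal (t ^ (r / p - 1)) := by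
    rw [← setLIntegral_congr (Ioo_ae_eq_Ioc (a := (0 : ℝ)) (b := (m : ℝ)) (μ := volume)),
      ← lintegral_indicator measurableSet_Ioi, ← lintegral_indicator measurableSet_Ioo]
    refine lintegral_congr fun t => ?_
    by_cases ht : 0 < t
    · have hlt : ENNReal.ofReal t < μ F ↔ t < m := by
        rw [← hm, ← ENNReal.ofReal_coe_nnreal, ENNReal.ofReal_lt_ofReal_iff_of_nonneg ht.le]
      by_cases htm : t < m
      · rw [indicator_of_mem (mem_Ioi.2 ht), indicator_of_mem (mem_Ioo.2 ⟨ht, htm⟩),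
          rearrangement_indicator_one, if_pos (hlt.2 htm),
          mul_one, ENNReal.ofReal_rpow_of_pos (by positivity), ← Real.rpow_mul ht.le]
        congr 2
        field_simp
      · rw [indicator_of_mem (mem_Ioi.2 ht), indicator_of_notMem fun h => htm h.2,
          rearrangement_indicator_one, if_neg (mt hlt.1 htm), mul_zero, ENNReal.zero_rpow_of_pos hr]
    · simp [indicator, ht]
  rw [h1, setLIntegral_Ioc_rpow (by linarith [div_pos hr hp]) m.coe_nonneg, sub_add_cancel,
    ENNReal.ofReal_rpow_of_nonneg (by positivity) (by positivity), ← hm,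
    ← ENNReal.ofReal_coe_nnreal, ENNReal.ofReal_rpow_of_nonneg (by positivity) (by positivity),
    ← ENNReal.ofReal_mul (by positivity), div_eq_mul_inv, Real.mul_rpow (by positivity)
    (by positivity), ← Real.rpow_mul m.coe_nonneg, inv_div, mul_comm]
  congr 3
  field_simp

end LorentzNorm

/-! ### Minkowski, Hölder, monotone convergence and duality for sequences. -/

section Sequences

variable {ι : Type*}

theorem tsum_Lp_add_le {q : ℝ} (hq : 1 ≤ q) (f g : ι → ℝ≥0∞) :
    (∑' i, (f i + g i) ^ q) ^ (1 / q) ≤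
      (∑' i, f i ^ q) ^ (1 / q) + (∑' i, g i ^ q) ^ (1 / q) := by
  let _ : MeasurableSpace ι := ⊤
  have h := ENNReal.lintegral_Lp_add_le (μ := Measure.count) (f := f) (g := g)
    measurable_from_top.aemeasurable measurable_from_top.aemeasurable hq
  simpa only [lintegral_count, Pi.add_apply] using h

theorem tsum_mul_le_Lp_mul_Lq {p q : ℝ} (hpq : p.HolderConjugate q) (f g : ι → ℝ≥0∞) :
    ∑' i, f i * g i ≤ (∑' i, f i ^ p) ^ (1 / p) * (∑' i, g i ^ q) ^ (1 / q) := by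
  let _ : MeasurableSpace ι := ⊤
  have h := ENNReal.lintegral_mul_le_Lp_mul_Lq Measure.count hpq (f := f) (g := g)
    measurable_from_top.aemeasurable measurable_from_top.aemeasurable
  simpa only [lintegral_count, Pi.mul_apply] using h

theorem tsum_iSup {f : ℕ → ι → ℝ≥0∞} (hf : Monotone f) :
    ∑' i, ⨆ n, f n i = ⨆ n, ∑' i, f n i := by
  let _ : MeasurableSpace ι := ⊤
  have h := lintegral_iSup (μ := Measure.count) (fun n => measurable_from_top (f := f n)) hf
  simpa only [lintegral_count] using h

/-- Boundedness of a weighted sequence functional forces the dual weight to be summable. -/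
theorem sum_rpow_conj_le_of_sum_mul_le {p q q' : ℝ} (hq : q.HolderConjugate q')
    (w m : ι → ℝ≥0) (hw : ∀ i, w i ≠ 0) (hp : p < 1) (C : ℝ≥0) (s : Finset ι)
    (h : ∀ c : ι → ℝ≥0, (∀ i ∉ s, c i = 0) →
      ∑ i ∈ s, c i * m i ≤ C * (∑ i ∈ s, (w i * c i * m i ^ p) ^ q) ^ (1 / q)) :
    ∑ i ∈ s, ((w i)⁻¹ * m i ^ (1 - p)) ^ q' ≤ C ^ q' := by
  classical
  set d : ι → ℝ≥0 := fun i => (w i)⁻¹ * m i ^ (1 - p) with hd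
  have hd0 : ∀ i, m i = 0 → d i = 0 := fun i hi => by
    simp [hd, hi, NNReal.zero_rpow (sub_pos.2 hp).ne']
  set S := ∑ i ∈ s, d i ^ q' with hS
  have hinv : 1 / q + 1 / q' = 1 := by simpa using hq.inv_add_inv_eq_one
  have hq'0 : 0 < q' := hq.symm.pos
  have hq0 : 0 < q := hq.pos
  have hexp : (q' - 1) * q = q' := by
    have := hq.mul_eq_add
    linarith [mul_comm q q']
  -- The equality case of Hölder. With this test sequence, `c m = d^{q'}` and `(w c m^p)^q =
  -- d^{(q'-1)q} = d^{q'}`, so both sums become `S` and the hypothesis reads `S ≤ C S^{1/q}`.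
  -- Indices with `m i = 0` contribute zero to both.
  have key := h (fun i => if i ∈ s then d i ^ (q' - 1) * (w i * m i ^ p)⁻¹ else 0)
    (fun i hi => by simp [hi])
  have h1 : ∑ i ∈ s, (if i ∈ s then d i ^ (q' - 1) * (w i * m i ^ p)⁻¹ else 0) * m i = S := by
    refine Finset.sum_congr rfl fun i hi => ?_
    rw [if_pos hi]
    by_cases hm : m i = 0
    · rw [hd0 i hm, hm, mul_zero, NNReal.zero_rpow hq'0.ne']
    · have hdi : (w i * m i ^ p)⁻¹ * m i = d i := by
        simp only [hd]
        rw [NNReal.rpow_sub hm, NNReal.rpow_one, mul_inv]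
        ring
      have hdi0 : d i ≠ 0 := mul_ne_zero (inv_ne_zero (hw i)) (by simp [NNReal.rpow_eq_zero_iff, hm])
      rw [mul_assoc, hdi, ← NNReal.rpow_add_one hdi0, sub_add_cancel]
  have h2 : ∑ i ∈ s, (w i * (if i ∈ s then d i ^ (q' - 1) * (w i * m i ^ p)⁻¹ else 0) *
      m i ^ p) ^ q = S := by
    refine Finset.sum_congr rfl fun i hi => ?_
    rw [if_pos hi]
    by_cases hm : m i = 0
    · have : d i ^ (q' - 1) = 0 := by
        rw [hd0 i hm, NNReal.zero_rpow]
        linarith [hq.symm.lt]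
      rw [this, hd0 i hm, NNReal.zero_rpow hq'0.ne']
      simp [hq0.ne']
    · have hmp : m i ^ p ≠ 0 := by simp [NNReal.rpow_eq_zero_iff, hm]
      have hwi := hw i
      rw [show w i * (d i ^ (q' - 1) * (w i * m i ^ p)⁻¹) * m i ^ p =
        d i ^ (q' - 1) by field_simp, ← NNReal.rpow_mul, hexp]
  rw [h1, h2] at key
  by_cases hS0 : S = 0
  · rw [hS0]; exact zero_le
  · have h4 : S ^ (1 / q') ≤ C := by
      have hSq : 0 < S ^ (1 / q) := NNReal.rpow_pos (pos_iff_ne_zero.2 hS0)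
      refine le_of_mul_le_mul_right ?_ hSq
      rwa [← NNReal.rpow_add hS0, add_comm, hinv, NNReal.rpow_one]
    calc S = (S ^ (1 / q')) ^ q' := by
          rw [← NNReal.rpow_mul, one_div_mul_cancel hq'0.ne', NNReal.rpow_one]
      _ ≤ C ^ q' := by gcongr

end Sequences

/-! ### The partition of the domain into shells. -/

section Shells

variable {N : ℕ} {Ω : Set (EuclideanSpace ℝ (Fin N))}

theorem norm_lt_of_mem_shell {u : ℤ} {x : Ω} (hx : x ∈ shell Ω u) :
    ‖(x : EuclideanSpace ℝ (Fin N))‖ < (2 : ℝ) ^ u := by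
  unfold shell at hx
  split_ifs at hx with h
  · have : ‖(x : EuclideanSpace ℝ (Fin N))‖ < 1 / 2 := hx
    rw [h]
    norm_num
    linarith
  · exact hx.2

theorem le_norm_of_mem_shell {u : ℤ} {x : Ω} (hu : u ≠ -1) (hx : x ∈ shell Ω u) :
    (2 : ℝ) ^ (u - 1) ≤ ‖(x : EuclideanSpace ℝ (Fin N))‖ := by
  rw [shell, if_neg hu] at hx
  exact hx.1

theorem measurableSet_shell [MeasurableSpace Ω] [OpensMeasurableSpace Ω] (u : ℤ) :
    MeasurableSet (shell Ω u) := by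
  have hn : Measurable fun x : Ω => ‖(x : EuclideanSpace ℝ (Fin N))‖ :=
    (continuous_norm.comp continuous_subtype_val).measurable
  unfold shell
  split_ifs
  · exact measurableSet_lt hn measurable_const
  · exact (measurableSet_le measurable_const hn).inter (measurableSet_lt hn measurable_const)

theorem exists_mem_shell (x : Ω) : ∃ u : Ici (-1 : ℤ), x ∈ shell Ω u := by
  by_cases h : ‖(x : EuclideanSpace ℝ (Fin N))‖ < 1 / 2
  · refine ⟨⟨-1, mem_Ici.2 le_rfl⟩, ?_⟩
    simpa [shell] using h
  · have h' : 1 / 2 ≤ ‖(x : EuclideanSpace ℝ (Fin N))‖ := not_lt.1 h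
    obtain ⟨n, hn1, hn2⟩ := exists_mem_Ico_zpow (x := ‖(x : EuclideanSpace ℝ (Fin N))‖) (y := 2)
      (by linarith) (by norm_num)
    -- The index of the shell is `n + 1`, since `2^n ≤ |x| < 2^{n+1}`. It exceeds `-1` because
    -- `2^{n+1} > |x| ≥ 1/2`.
    have hn : -1 < n + 1 := by
      rw [← zpow_lt_zpow_iff_right₀ (a := (2 : ℝ)) (by norm_num)]
      refine lt_of_le_of_lt ?_ hn2
      norm_num
      linarith
    refine ⟨⟨n + 1, mem_Ici.2 hn.le⟩, ?_⟩
    have hne : n + 1 ≠ -1 := hn.ne'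
    simp only [shell, if_neg hne]
    exact ⟨by simpa using hn1, hn2⟩

theorem eq_of_mem_shell {u v : Ici (-1 : ℤ)} {x : Ω} (hu : x ∈ shell Ω u) (hv : x ∈ shell Ω v) :
    u = v := by
  have key : ∀ u v : Ici (-1 : ℤ), x ∈ shell Ω u → x ∈ shell Ω v → ¬ u < v := by
    intro u v hu hv h
    have hlt : (u : ℤ) < v := h
    have h1 := norm_lt_of_mem_shell hu
    have hvne : (v : ℤ) ≠ -1 := by have := mem_Ici.1 u.2; lia
    have h2 := le_norm_of_mem_shell hvne hv
    have h3 : (2 : ℝ) ^ (u : ℤ) ≤ 2 ^ ((v : ℤ) - 1) :=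
      zpow_le_zpow_right₀ (by norm_num) (by lia)
    linarith
  exact le_antisymm (not_lt.1 (key v u hv hu)) (not_lt.1 (key u v hu hv))

/-- The index of the shell that contains a given point. -/
noncomputable def shellIndex (x : Ω) : Ici (-1 : ℤ) := (exists_mem_shell x).choose

theorem shellIndex_eq_iff {x : Ω} {u : Ici (-1 : ℤ)} : shellIndex x = u ↔ x ∈ shell Ω u :=
  ⟨fun h => h ▸ (exists_mem_shell x).choose_spec,
    fun h => eq_of_mem_shell (exists_mem_shell x).choose_spec h⟩

theorem measurable_shellIndex [MeasurableSpace Ω] [OpensMeasurableSpace Ω] :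
    Measurable (shellIndex : Ω → Ici (-1 : ℤ)) := by
  refine measurable_to_countable' fun u => ?_
  convert measurableSet_shell (Ω := Ω) (u : ℤ)
  ext x
  simp [shellIndex_eq_iff]

theorem setLIntegral_eq_tsum_shell [MeasurableSpace Ω] [OpensMeasurableSpace Ω] (μ : Measure Ω)
    {E : Set Ω} (hE : MeasurableSet E) (f : Ω → ℝ≥0∞) :
    ∫⁻ x in E, f x ∂μ = ∑' u : Ici (-1 : ℤ), ∫⁻ x in shell Ω u ∩ E, f x ∂μ := by
  rw [← lintegral_iUnion (s := fun u : Ici (-1 : ℤ) => shell Ω u ∩ E)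
    (fun u => (measurableSet_shell (u : ℤ)).inter hE)]
  · congr 2
    ext x
    simp only [mem_iUnion, mem_inter_iff, exists_and_right]
    exact ⟨fun h => ⟨exists_mem_shell x, h⟩, fun h => h.2⟩
  · intro u v huv
    refine Set.disjoint_left.2 fun x hu hv => huv (eq_of_mem_shell hu.1 hv.1)

/-- The norm is bounded on a compact set, while it is at least `2^{u-1}` on the shell `A_u` with `u
≥ 0`. -/
theorem exists_finset_shell_cover {K : Set Ω} (hK : IsCompact K) :
    ∃ s : Finset (Ici (-1 : ℤ)), ∀ x ∈ K, shellIndex x ∈ s := by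
  have hc : Continuous fun x : Ω => ‖(x : EuclideanSpace ℝ (Fin N))‖ :=
    continuous_norm.comp continuous_subtype_val
  obtain ⟨R, hR⟩ := (hK.image hc).bddAbove
  obtain ⟨n, hn⟩ := pow_unbounded_of_one_lt R (one_lt_two : (1 : ℝ) < 2)
  have hfin : {u : Ici (-1 : ℤ) | (u : ℤ) ∈ Icc (-1 : ℤ) n}.Finite :=
    (finite_Icc (-1 : ℤ) n).preimage Subtype.val_injective.injOn
  refine ⟨hfin.toFinset, fun x hx => ?_⟩
  rw [Finite.mem_toFinset]
  refine ⟨(shellIndex x).2, ?_⟩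
  by_cases h : (shellIndex x : ℤ) = -1
  · rw [h]; lia
  · have h1 := le_norm_of_mem_shell h (shellIndex_eq_iff.1 rfl)
    have h2 : ‖(x : EuclideanSpace ℝ (Fin N))‖ ≤ R := hR (mem_image_of_mem _ hx)
    have h3 : (2 : ℝ) ^ ((shellIndex x : ℤ) - 1) < 2 ^ (n : ℤ) := by
      rw [zpow_natCast]; linarith
    rw [zpow_lt_zpow_iff_right₀ (by norm_num)] at h3
    lia

end Shells

/-! ### The Herz functionals: norm properties, test functions and the associate estimate. -/

section HerzNorm

theorem enorm_indicator_comp {α ε : Type*} [NormedAddCommGroup ε] (S : Set α) (f : α → ε) :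
    (fun x => ‖S.indicator f x‖ₑ) = S.indicator fun x => ‖f x‖ₑ :=
  funext fun x => enorm_indicator_eq_indicator_enorm f x

variable {N : ℕ} {Ω : Set (EuclideanSpace ℝ (Fin N))} [MeasurableSpace Ω] {μ : Measure Ω}
  {a p q r : ℝ}

/-- The weight `2^{ua}` of the shell `A_u`. -/
noncomputable def shellWeight (a : ℝ) (u : ℤ) : ℝ≥0 := 2 ^ ((u : ℝ) * a)

theorem shellWeight_pos (a : ℝ) (u : ℤ) : 0 < shellWeight a u := NNReal.rpow_pos two_pos

theorem two_rpow_eq_coe_shellWeight_rpow (a b : ℝ) (u : ℤ) :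
    (2 : ℝ≥0∞) ^ ((u : ℝ) * a * b) = (shellWeight a u : ℝ≥0∞) ^ b := by
  rw [shellWeight, ENNReal.coe_rpow_of_ne_zero two_ne_zero, ENNReal.rpow_mul]
  rfl

theorem herzNorm_eq (hq : 0 ≤ q) (f : Ω → ℝ≥0∞) :
    herzNorm μ a p q r f = (∑' u : Ici (-1 : ℤ), ((shellWeight a u : ℝ≥0∞) *
      lorentzNorm μ p r ((shell Ω u).indicator f)) ^ q) ^ (1 / q) := by
  simp only [herzNorm, two_rpow_eq_coe_shellWeight_rpow, ENNReal.mul_rpow_of_nonneg _ _ hq]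

theorem herzQuasinorm_eq (hq : 0 ≤ q) (f : Ω → ℝ≥0∞) :
    herzQuasinorm μ a p q r f = (∑' u : Ici (-1 : ℤ), ((shellWeight a u : ℝ≥0∞) *
      lorentzQuasinorm μ p r ((shell Ω u).indicator f)) ^ q) ^ (1 / q) := by
  simp only [herzQuasinorm, two_rpow_eq_coe_shellWeight_rpow, ENNReal.mul_rpow_of_nonneg _ _ hq]

theorem herzNorm_enorm {ε : Type*} [NormedAddCommGroup ε] (f : Ω → ε) :
    herzNorm μ a p q r (fun x => ‖f x‖ₑ) = herzNorm μ a p q r f := by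
  simp only [herzNorm, ← enorm_indicator_comp, lorentzNorm_enorm]

theorem herzQuasinorm_enorm {ε : Type*} [NormedAddCommGroup ε] (f : Ω → ε) :
    herzQuasinorm μ a p q r (fun x => ‖f x‖ₑ) = herzQuasinorm μ a p q r f := by
  simp only [herzQuasinorm, ← enorm_indicator_comp, lorentzQuasinorm_enorm]

theorem herzNorm_mono_ae (hq : 0 ≤ q) (hr : 0 ≤ r) {f g : Ω → ℝ≥0∞} (h : ∀ᵐ x ∂μ, f x ≤ g x) :
    herzNorm μ a p q r f ≤ herzNorm μ a p q r g := by
  simp only [herzNorm_eq hq]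
  gcongr with u
  refine lorentzNorm_mono_ae hr ?_
  filter_upwards [h] with x hx
  exact indicator_le_indicator hx

theorem herzNorm_congr_ae (hq : 0 ≤ q) (hr : 0 ≤ r) {f g : Ω → ℝ≥0∞} (h : f =ᵐ[μ] g) :
    herzNorm μ a p q r f = herzNorm μ a p q r g :=
  le_antisymm (herzNorm_mono_ae hq hr h.le) (herzNorm_mono_ae hq hr h.symm.le)

theorem herzQuasinorm_le_herzNorm (hq : 0 ≤ q) (hr : 0 ≤ r) (f : Ω → ℝ≥0∞) :
    herzQuasinorm μ a p q r f ≤ herzNorm μ a p q r f := by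
  rw [herzNorm_eq hq, herzQuasinorm_eq hq]
  gcongr with u
  exact lorentzQuasinorm_le_lorentzNorm hr _

theorem exists_herzNorm_le_herzQuasinorm (hp : 1 < p) (hq : 0 < q) (hr : 1 < r) (a : ℝ)
    (μ : Measure Ω) :
    ∃ C : ℝ≥0, ∀ f : Ω → ℝ≥0∞, herzNorm μ a p q r f ≤ C * herzQuasinorm μ a p q r f := by
  obtain ⟨C, hC⟩ := exists_lorentzNorm_le_lorentzQuasinorm hp hr μ
  refine ⟨C, fun f => ?_⟩
  rw [herzNorm_eq hq.le, herzQuasinorm_eq hq.le]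
  calc _ ≤ (∑' u : Ici (-1 : ℤ), (C * ((shellWeight a u : ℝ≥0∞) *
      lorentzQuasinorm μ p r ((shell Ω u).indicator f))) ^ q) ^ (1 / q) := by
        gcongr (∑' u, ?_ ^ q) ^ (1 / q) with u
        rw [mul_left_comm]
        exact mul_le_mul_right (hC _) _
    _ = _ := by
        simp only [ENNReal.mul_rpow_of_nonneg (C : ℝ≥0∞) _ hq.le]
        rw [ENNReal.tsum_mul_left, ENNReal.mul_rpow_of_nonneg _ _ (by positivity),
          ← ENNReal.rpow_mul, mul_one_div_cancel hq.ne', ENNReal.rpow_one]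

theorem herzNorm_const_mul (hq : 0 < q) (hr : 0 < r) (c : ℝ≥0) (f : Ω → ℝ≥0∞) :
    herzNorm μ a p q r (fun x => (c : ℝ≥0∞) * f x) = c * herzNorm μ a p q r f := by
  have h : ∀ u : ℤ, (shell Ω u).indicator (fun x => (c : ℝ≥0∞) * f x) =
      fun x => (c : ℝ≥0∞) * (shell Ω u).indicator f x := by
    intro u
    ext x
    by_cases hx : x ∈ shell Ω u <;> simp [hx]
  simp only [herzNorm_eq hq.le, h, lorentzNorm_const_mul hr, mul_left_comm _ (c : ℝ≥0∞),
    ENNReal.mul_rpow_of_nonneg (c : ℝ≥0∞) _ hq.le]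
  rw [ENNReal.tsum_mul_left, ENNReal.mul_rpow_of_nonneg _ _ (by positivity),
    ← ENNReal.rpow_mul, mul_one_div_cancel hq.ne', ENNReal.rpow_one]

theorem herzNorm_iSup (hq : 0 < q) (hr : 0 < r) {f : ℕ → Ω → ℝ≥0∞} (hf : Monotone f) :
    herzNorm μ a p q r (fun x => ⨆ n, f n x) = ⨆ n, herzNorm μ a p q r (f n) := by
  have h : ∀ u : ℤ, (shell Ω u).indicator (fun x => ⨆ n, f n x) =
      fun x => ⨆ n, (shell Ω u).indicator (f n) x := by
    intro u
    ext x
    by_cases hx : x ∈ shell Ω u <;> simp [hx]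
  have hmono : ∀ u : ℤ, Monotone fun n => (shell Ω u).indicator (f n) :=
    fun u m n hmn => indicator_mono (hf hmn)
  simp only [herzNorm_eq hq.le, h, lorentzNorm_iSup hr (hmono _), ENNReal.mul_iSup]
  have h2 : ∀ φ : ℕ → ℝ≥0∞, (⨆ n, φ n) ^ q = ⨆ n, φ n ^ q :=
    fun φ => (ENNReal.orderIsoRpow q hq).map_iSup φ
  simp only [h2]
  rw [tsum_iSup]
  · exact (ENNReal.orderIsoRpow (1 / q) (by positivity)).map_iSup _
  · intro m n hmn u
    dsimp only
    gcongr
    exact lorentzNorm_mono_ae hr.le (ae_of_all _ (hmono u hmn))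

theorem monotone_and_tendsto_herzNorm (hq : 0 < q) (hr : 0 < r) {f : ℕ → Ω → ℝ≥0∞}
    {g : Ω → ℝ≥0∞}
    (h : ∀ᵐ x ∂μ, Monotone (fun n => f n x) ∧ Tendsto (fun n => f n x) atTop (𝓝 (g x))) :
    Monotone (fun n => herzNorm μ a p q r (f n)) ∧
      Tendsto (fun n => herzNorm μ a p q r (f n)) atTop (𝓝 (herzNorm μ a p q r g)) := by
  have hmono : Monotone (fun n => herzNorm μ a p q r (f n)) := by
    intro m n hmn
    refine herzNorm_mono_ae hq.le hr.le ?_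
    filter_upwards [h] with x hx
    exact hx.1 hmn
  refine ⟨hmono, ?_⟩
  -- Partial suprema replace a sequence increasing only a.e. by one that increases everywhere,
  -- without changing any term off a null set.
  have h1 : ∀ n, herzNorm μ a p q r (partialSups f n) = herzNorm μ a p q r (f n) := by
    intro n
    refine herzNorm_congr_ae hq.le hr.le ?_
    filter_upwards [h] with x hx
    rw [Pi.partialSups_apply, hx.1.partialSups_eq]
  have h2 : herzNorm μ a p q r g = herzNorm μ a p q r (fun x => ⨆ n, partialSups f n x) := by
    refine herzNorm_congr_ae hq.le hr.le ?_
    filter_upwards [h] with x hx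
    simp only [Pi.partialSups_apply, hx.1.partialSups_eq]
    exact tendsto_nhds_unique hx.2 (tendsto_atTop_iSup hx.1)
  rw [h2, herzNorm_iSup hq hr (partialSups f).monotone]
  simp only [h1]
  exact tendsto_atTop_iSup hmono

/-- On each shell the function is a constant multiple of an indicator, so its norm is explicit.
Taking `c = 1` yields (a); general `c` provides the test functions for (b). -/
theorem herzQuasinorm_indicator_comp_shellIndex (hp : 0 < p) (hq : 0 < q) (hr : 0 < r)
    {E : Set Ω} (hE : μ E < ∞) (c : Ici (-1 : ℤ) → ℝ≥0) :
    herzQuasinorm μ a p q r (E.indicator fun x => (c (shellIndex x) : ℝ≥0∞)) =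
      ENNReal.ofReal ((p / r) ^ (1 / r)) * (∑' u : Ici (-1 : ℤ),
        ((shellWeight a u : ℝ≥0∞) * c u * μ (shell Ω u ∩ E) ^ (1 / p)) ^ q) ^ (1 / q) := by
  have h : ∀ u : Ici (-1 : ℤ), (shell Ω (u : ℤ)).indicator
      (E.indicator fun x => (c (shellIndex x) : ℝ≥0∞)) =
      fun x => (c u : ℝ≥0∞) * (shell Ω (u : ℤ) ∩ E).indicator (1 : Ω → ℝ≥0∞) x := by
    intro u
    ext x
    rw [indicator_indicator]
    by_cases hx : x ∈ shell Ω (u : ℤ) ∩ E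
    · rw [indicator_of_mem hx, indicator_of_mem hx, shellIndex_eq_iff.2 hx.1]
      simp
    · rw [indicator_of_notMem hx, indicator_of_notMem hx, mul_zero]
  have h2 : ∀ u : Ici (-1 : ℤ), lorentzQuasinorm μ p r ((shell Ω (u : ℤ) ∩ E).indicator
      (1 : Ω → ℝ≥0∞)) = ENNReal.ofReal ((p / r) ^ (1 / r)) * μ (shell Ω (u : ℤ) ∩ E) ^ (1 / p) :=
    fun u => lorentzQuasinorm_indicator_one hp hr (measure_inter_lt_top_of_right_ne_top hE.ne).ne
  rw [herzQuasinorm_eq hq.le]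
  simp only [h, lorentzQuasinorm_const_mul hr, h2]
  set K := ENNReal.ofReal ((p / r) ^ (1 / r))
  have h3 : ∀ u : Ici (-1 : ℤ), ((shellWeight a u : ℝ≥0∞) *
      (c u * (K * μ (shell Ω u ∩ E) ^ (1 / p)))) ^ q =
      K ^ q * ((shellWeight a u : ℝ≥0∞) * c u * μ (shell Ω u ∩ E) ^ (1 / p)) ^ q := by
    intro u
    rw [← ENNReal.mul_rpow_of_nonneg _ _ hq.le]
    congr 1
    ring
  simp only [h3]
  rw [ENNReal.tsum_mul_left, ENNReal.mul_rpow_of_nonneg _ _ (by positivity),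
    ← ENNReal.rpow_mul, mul_one_div_cancel hq.ne', ENNReal.rpow_one]

theorem herzQuasinorm_indicator_one_lt_top_iff (hp : 0 < p) (hq : 0 < q) (hr : 0 < r)
    {E : Set Ω} (hE : μ E < ∞) : herzQuasinorm μ a p q r (E.indicator (1 : Ω → ℝ≥0∞)) < ∞ ↔
      ∑' u : Ici (-1 : ℤ), (2 : ℝ≥0∞) ^ (((u : ℤ) : ℝ) * a * q) *
        μ (shell Ω u ∩ E) ^ (q / p) < ∞ := by
  have h := herzQuasinorm_indicator_comp_shellIndex (a := a) hp hq hr hE fun _ => 1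
  have h1 : (E.indicator fun _ => ((1 : ℝ≥0) : ℝ≥0∞)) = E.indicator (1 : Ω → ℝ≥0∞) := by
    simp [Pi.one_def]
  have h2 : ∀ u : Ici (-1 : ℤ), ((shellWeight a u : ℝ≥0∞) * ((1 : ℝ≥0) : ℝ≥0∞) *
      μ (shell Ω u ∩ E) ^ (1 / p)) ^ q = (2 : ℝ≥0∞) ^ (((u : ℤ) : ℝ) * a * q) *
        μ (shell Ω u ∩ E) ^ (q / p) := by
    intro u
    rw [ENNReal.coe_one, mul_one, ENNReal.mul_rpow_of_nonneg _ _ hq.le, ← ENNReal.rpow_mul,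
      two_rpow_eq_coe_shellWeight_rpow, one_div_mul_eq_div]
  rw [h1] at h
  simp only [h2] at h
  rw [h, ENNReal.mul_lt_top_iff]
  have hK : 0 < ENNReal.ofReal ((p / r) ^ (1 / r)) :=
    ENNReal.ofReal_pos.2 (Real.rpow_pos_of_pos (div_pos hp hr) _)
  have hq1 : 0 < 1 / q := by positivity
  simp only [ENNReal.ofReal_lt_top, true_and, hK.ne', false_or,
    ENNReal.rpow_lt_top_iff_of_pos hq1, ENNReal.rpow_eq_zero_iff_of_pos hq1]
  constructor
  · rintro (h | h)
    · exact h
    · rw [h]; exact ENNReal.zero_lt_top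
  · exact Or.inl

variable [OpensMeasurableSpace Ω]

theorem herzNorm_add_le [SFinite μ] (hq : 1 ≤ q) (hr : 1 ≤ r) {f g : Ω → ℝ≥0∞}
    (hf : Measurable f) (hg : Measurable g) : herzNorm μ a p q r (fun x => f x + g x) ≤
      herzNorm μ a p q r f + herzNorm μ a p q r g := by
  have hq0 : 0 ≤ q := by linarith
  simp only [herzNorm_eq hq0]
  refine le_trans ?_ (tsum_Lp_add_le hq _ _)
  gcongr with u
  rw [← mul_add]
  gcongr
  have h : (shell Ω u).indicator (fun x => f x + g x) =
      fun x => (shell Ω u).indicator f x + (shell Ω u).indicator g x :=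
    indicator_add _ f g
  rw [h]
  exact lorentzNorm_add_le hr (hf.indicator (measurableSet_shell _))
    (hg.indicator (measurableSet_shell _))

theorem herzNorm_eq_zero_iff [SFinite μ] (hp : 1 < p) (hq : 0 < q) (hr : 1 < r) {f : Ω → ℝ≥0∞}
    (hf : Measurable f) : herzNorm μ a p q r f = 0 ↔ f =ᵐ[μ] 0 := by
  have hr0 : 0 < r := by linarith
  constructor
  · intro h
    rw [herzNorm_eq hq.le, ENNReal.rpow_eq_zero_iff_of_pos (by positivity),
      ENNReal.tsum_eq_zero] at h
    have h1 : ∀ u : Ici (-1 : ℤ), (shell Ω u).indicator f =ᵐ[μ] 0 := by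
      intro u
      have hu := h u
      rw [ENNReal.rpow_eq_zero_iff_of_pos hq, mul_eq_zero] at hu
      refine ae_eq_zero_of_lorentzNorm_eq_zero hp hr (hf.indicator (measurableSet_shell _))
        (hu.resolve_left ?_)
      exact_mod_cast (shellWeight_pos a u).ne'
    filter_upwards [ae_all_iff.2 h1] with x hx
    have := hx (shellIndex x)
    rwa [indicator_of_mem (shellIndex_eq_iff.1 rfl)] at this
  · intro h
    -- An a.e. zero function agrees a.e. with `0 · f`, so homogeneity gives norm zero.
    have h0 : herzNorm μ a p q r f = herzNorm μ a p q r (fun x => ((0 : ℝ≥0) : ℝ≥0∞) * f x) := by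
      refine herzNorm_congr_ae hq.le hr0.le ?_
      filter_upwards [h] with x hx
      simp [hx]
    rw [h0, herzNorm_const_mul hq hr0]
    simp

/-- Finiteness of the Herz sum makes each shell piece finite, since the weights are nonzero. On `K`
the function is dominated by a finite sum of such pieces. -/
theorem lorentzNorm_indicator_lt_top_of_isCompact [SFinite μ] (hq : 0 < q) (hr : 1 ≤ r)
    {f : Ω → ℝ≥0∞} (hf : Measurable f) (h : herzNorm μ a p q r f < ∞) {K : Set Ω}
    (hK : IsCompact K) : lorentzNorm μ p r (K.indicator f) < ∞ := by
  have hr0 : 0 ≤ r := by linarith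
  obtain ⟨s, hs⟩ := exists_finset_shell_cover hK
  have h1 : ∀ u : Ici (-1 : ℤ), lorentzNorm μ p r ((shell Ω u).indicator f) < ∞ := by
    intro u
    rw [herzNorm_eq hq.le, ENNReal.rpow_lt_top_iff_of_pos (by positivity)] at h
    have h2 := lt_of_le_of_lt (ENNReal.le_tsum u) h
    rw [ENNReal.rpow_lt_top_iff_of_pos hq] at h2
    refine ENNReal.lt_top_of_mul_ne_top_right h2.ne ?_
    exact_mod_cast (shellWeight_pos a u).ne'
  refine lt_of_le_of_lt (lorentzNorm_mono_ae (g := fun x => ∑ u ∈ s,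
    (shell Ω (u : ℤ)).indicator f x) hr0 (ae_of_all _ fun x => ?_)) ?_
  · by_cases hx : x ∈ K
    · rw [indicator_of_mem hx]
      calc f x = (shell Ω (shellIndex x : ℤ)).indicator f x := by
            rw [indicator_of_mem (shellIndex_eq_iff.1 rfl)]
        _ ≤ _ := Finset.single_le_sum (f := fun u : Ici (-1 : ℤ) => (shell Ω (u : ℤ)).indicator f x)
            (fun _ _ => zero_le) (hs x hx)
    · simp [hx]
  · refine lt_of_le_of_lt (lorentzNorm_sum_le hr (f := fun (u : Ici (-1 : ℤ)) =>
      (shell Ω (u : ℤ)).indicator f) (fun u => hf.indicator (measurableSet_shell _)) s) ?_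
    exact ENNReal.sum_lt_top.2 fun u _ => h1 u

theorem mem_herzSpace_iff {𝕜 : Type*} [RCLike 𝕜] [SFinite μ] (hp : 1 < p) (hq : 0 < q)
    (hr : 1 < r) {f : Ω → 𝕜} : f ∈ herzSpace 𝕜 μ a p q r ↔
      Measurable f ∧ herzNorm μ a p q r (fun x => ‖f x‖ₑ) < ∞ := by
  have hr0 : 0 ≤ r := by linarith
  constructor
  · rintro ⟨⟨hf, -⟩, hn⟩
    refine ⟨hf, ?_⟩
    obtain ⟨C, hC⟩ := exists_herzNorm_le_herzQuasinorm hp hq hr a μ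
    refine (hC _).trans_lt (ENNReal.mul_lt_top ENNReal.coe_lt_top ?_)
    rwa [herzQuasinorm_enorm]
  · rintro ⟨hf, hn⟩
    refine ⟨⟨hf, fun K hK => ⟨hf.indicator hK.measurableSet, ?_⟩⟩, ?_⟩
    · rw [← lorentzQuasinorm_enorm, enorm_indicator_comp]
      exact (lorentzQuasinorm_le_lorentzNorm hr0 _).trans_lt
        (lorentzNorm_indicator_lt_top_of_isCompact hq hr.le hf.enorm hn hK)
    · rw [← herzQuasinorm_enorm]
      exact (herzQuasinorm_le_herzNorm hq.le hr0 _).trans_lt hn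

theorem exists_setLIntegral_le_herzNorm [SFinite μ] (hp : 1 < p) (hq : 1 < q) (hr : 1 < r)
    {E : Set Ω} (hE : MeasurableSet E) (hEt : μ E < ∞)
    (hb : ∑' u : Ici (-1 : ℤ), (2 : ℝ≥0∞) ^ (-(((u : ℤ) : ℝ) * a * q.conjExponent)) *
      μ (shell Ω u ∩ E) ^ (q.conjExponent / p.conjExponent) < ∞) :
    ∃ C : ℝ≥0, 0 < C ∧ ∀ f : Ω → ℝ≥0∞, Measurable f →
      ∫⁻ x in E, f x ∂μ ≤ C * herzNorm μ a p q r f := by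
  have hc : q.HolderConjugate q.conjExponent := Real.HolderConjugate.conjExponent hq
  set q' := q.conjExponent
  have hq'0 : 0 < q' := hc.symm.pos
  have hq0 : 0 < q := hc.pos
  obtain ⟨C, hC⟩ := exists_setLIntegral_le_lorentzNorm (μ := μ) hp hr
  set d : Ici (-1 : ℤ) → ℝ≥0∞ :=
    fun u => (shellWeight a u : ℝ≥0∞)⁻¹ * μ (shell Ω u ∩ E) ^ (1 - 1 / p) with hd
  -- This is condition (b), because `(1 - 1/p) q' = q'/p'`.
  have hdsum : ∑' u, d u ^ q' < ∞ := by
    convert hb using 4 with u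
    rw [hd, ENNReal.mul_rpow_of_nonneg _ _ hq'0.le, ← ENNReal.rpow_mul, ENNReal.inv_rpow,
      ← two_rpow_eq_coe_shellWeight_rpow, ENNReal.rpow_neg]
    congr 2
    rw [Real.conjExponent]
    have : p - 1 ≠ 0 := by linarith
    field_simp
  obtain ⟨D, hD⟩ : ∃ D : ℝ≥0, (D : ℝ≥0∞) = (∑' u, d u ^ q') ^ (1 / q') :=
    ⟨_, ENNReal.coe_toNNReal (ENNReal.rpow_lt_top_of_nonneg (one_div_nonneg.2 hq'0.le) hdsum.ne).ne⟩
  -- The summand `1` only secures positivity of the constant; `C * D` may be zero.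
  refine ⟨C * D + 1, by positivity, fun f hf => ?_⟩
  rw [setLIntegral_eq_tsum_shell μ hE]
  calc ∑' u : Ici (-1 : ℤ), ∫⁻ x in shell Ω u ∩ E, f x ∂μ
      ≤ ∑' u : Ici (-1 : ℤ), C * ((shellWeight a u : ℝ≥0∞) *
          lorentzNorm μ p r ((shell Ω u).indicator f) * d u) := by
        refine ENNReal.tsum_le_tsum fun u => ?_
        have hw0 : (shellWeight a u : ℝ≥0∞) ≠ 0 := by exact_mod_cast (shellWeight_pos a u).ne'
        have hS := (measurableSet_shell (Ω := Ω) (u : ℤ))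
        calc ∫⁻ x in shell Ω u ∩ E, f x ∂μ
            = ∫⁻ x in shell Ω u ∩ E, (shell Ω u).indicator f x ∂μ :=
              setLIntegral_congr_fun (hS.inter hE) fun x hx => by
                rw [indicator_of_mem hx.1]
          _ ≤ C * μ (shell Ω u ∩ E) ^ (1 - 1 / p) *
                lorentzNorm μ p r ((shell Ω u).indicator f) :=
              hC _ _ (hf.indicator hS) (hS.inter hE)
                (measure_inter_lt_top_of_right_ne_top hEt.ne)
          _ = C * ((shellWeight a u : ℝ≥0∞) * (shellWeight a u : ℝ≥0∞)⁻¹ *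
                μ (shell Ω u ∩ E) ^ (1 - 1 / p) *
                lorentzNorm μ p r ((shell Ω u).indicator f)) := by
              rw [ENNReal.mul_inv_cancel hw0 ENNReal.coe_ne_top, one_mul, mul_assoc]
          _ = _ := by rw [hd]; ring
    _ = C * ∑' u : Ici (-1 : ℤ), (shellWeight a u : ℝ≥0∞) *
          lorentzNorm μ p r ((shell Ω u).indicator f) * d u := ENNReal.tsum_mul_left
    _ ≤ C * (herzNorm μ a p q r f * D) := by
        rw [hD, herzNorm_eq hq0.le]
        gcongr
        exact tsum_mul_le_Lp_mul_Lq hc _ _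
    _ = (C * D : ℝ≥0) * herzNorm μ a p q r f := by rw [ENNReal.coe_mul]; ring
    _ ≤ _ := by
        gcongr
        exact le_self_add

end HerzNorm

/-! ### Sufficiency and necessity of the two conditions. -/

section Characterization

variable {N : ℕ} {Ω : Set (EuclideanSpace ℝ (Fin N))} [MeasurableSpace Ω] {μ : Measure Ω}
  {a p q r : ℝ} [OpensMeasurableSpace Ω]

theorem isFunctionNorm_herzNorm [SFinite μ] (hp : 1 < p) (hq : 1 < q) (hr : 1 < r)
    (ha : ∀ E : Set Ω, MeasurableSet E → μ E < ∞ →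
      ∑' u : Ici (-1 : ℤ), (2 : ℝ≥0∞) ^ (((u : ℤ) : ℝ) * a * q) * μ (shell Ω u ∩ E) ^ (q / p) < ∞)
    (hb : ∀ E : Set Ω, MeasurableSet E → μ E < ∞ →
      ∑' u : Ici (-1 : ℤ), (2 : ℝ≥0∞) ^ (-(((u : ℤ) : ℝ) * a * q.conjExponent)) *
        μ (shell Ω u ∩ E) ^ (q.conjExponent / p.conjExponent) < ∞) :
    IsFunctionNorm μ (herzNorm (ε := ℝ≥0∞) μ a p q r) := by
  have hp0 : 0 < p := by linarith
  have hq0 : 0 < q := by linarith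
  have hr0 : 0 < r := by linarith
  exact
  { eq_zero_iff := fun f hf => herzNorm_eq_zero_iff hp hq0 hr hf
    smul := fun c f _ => herzNorm_const_mul hq0 hr0 c f
    add_le := fun f g hf hg => herzNorm_add_le hq.le hr.le hf hg
    mono := fun f g _ _ h => herzNorm_mono_ae hq0.le hr0.le h
    fatou := fun f g _ _ h => monotone_and_tendsto_herzNorm hq0 hr0 h
    indicator_lt_top := fun E hE hEt => by
      obtain ⟨C, hC⟩ := exists_herzNorm_le_herzQuasinorm hp hq0 hr a μ
      exact (hC _).trans_lt (ENNReal.mul_lt_top ENNReal.coe_lt_top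
        ((herzQuasinorm_indicator_one_lt_top_iff hp0 hq0 hr0 hEt).2 (ha E hE hEt)))
    setLIntegral_le := fun E hE hEt =>
      exists_setLIntegral_le_herzNorm hp hq hr hE hEt (hb E hE hEt) }

/-- The estimate is assumed only for finite-valued `g` of finite norm, because these are the moduli
on which an abstract function norm is known to agree with `herzNorm`. -/
theorem tsum_conj_lt_top_of_setLIntegral_le (hp : 1 < p) (hq : 1 < q) (hr : 1 < r)
    {E : Set Ω} (hE : MeasurableSet E) (hEt : μ E < ∞) (C : ℝ≥0)
    (h : ∀ g : Ω → ℝ≥0, Measurable g → herzNorm μ a p q r (fun x => (g x : ℝ≥0∞)) < ∞ →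
      ∫⁻ x in E, g x ∂μ ≤ C * herzNorm μ a p q r (fun x => (g x : ℝ≥0∞))) :
    ∑' u : Ici (-1 : ℤ), (2 : ℝ≥0∞) ^ (-(((u : ℤ) : ℝ) * a * q.conjExponent)) *
      μ (shell Ω u ∩ E) ^ (q.conjExponent / p.conjExponent) < ∞ := by
  have hc : q.HolderConjugate q.conjExponent := Real.HolderConjugate.conjExponent hq
  set q' := q.conjExponent
  have hq'0 : 0 < q' := hc.symm.pos
  have hq0 : 0 < q := hc.pos
  have hp0 : 0 < p := by linarith
  have hr0 : 0 < r := by linarith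
  have hp1 : 1 / p < 1 := by rw [div_lt_one hp0]; exact hp
  obtain ⟨D, hD⟩ := exists_herzNorm_le_herzQuasinorm hp hq0 hr a μ
  set K : ℝ≥0 := ((p / r) ^ (1 / r)).toNNReal with hK
  set m : Ici (-1 : ℤ) → ℝ≥0 := fun u => (μ (shell Ω u ∩ E)).toNNReal with hm
  have hmμ : ∀ u : Ici (-1 : ℤ), (m u : ℝ≥0∞) = μ (shell Ω u ∩ E) := fun u =>
    ENNReal.coe_toNNReal (measure_inter_lt_top_of_right_ne_top hEt.ne).ne
  have hw : ∀ u : Ici (-1 : ℤ), shellWeight a u ≠ 0 := fun u => (shellWeight_pos a u).ne'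
  -- Restricting to finitely many shells gives the test functions finite norm. The bound does not
  -- depend on `s`, so it passes to the full series.
  have bound : ∀ s : Finset (Ici (-1 : ℤ)),
      ∑ u ∈ s, ((shellWeight a u)⁻¹ * m u ^ (1 - 1 / p)) ^ q' ≤ (C * D * K) ^ q' := by
    intro s
    refine sum_rpow_conj_le_of_sum_mul_le hc _ m hw hp1 _ s fun c hcs => ?_
    set g : Ω → ℝ≥0 := E.indicator fun x => c (shellIndex x) with hg
    have hgm : Measurable g :=
      ((Measurable.of_discrete (f := c)).comp measurable_shellIndex).indicator hE
    have hge : (fun x => (g x : ℝ≥0∞)) = E.indicator fun x => (c (shellIndex x) : ℝ≥0∞) := by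
      ext x
      by_cases hx : x ∈ E <;> simp [hg, hx]
    have hQ : herzQuasinorm μ a p q r (fun x => (g x : ℝ≥0∞)) =
        ((K * (∑ u ∈ s, (shellWeight a u * c u * m u ^ (1 / p)) ^ q) ^ (1 / q) : ℝ≥0) :
          ℝ≥0∞) := by
      rw [hge, herzQuasinorm_indicator_comp_shellIndex hp0 hq0 hr0 hEt, tsum_eq_sum (s := s)]
      · have hterm : ∀ u : Ici (-1 : ℤ), ((shellWeight a u : ℝ≥0∞) * c u *
            μ (shell Ω u ∩ E) ^ (1 / p)) ^ q =
            (((shellWeight a u * c u * m u ^ (1 / p)) ^ q : ℝ≥0) : ℝ≥0∞) := by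
          intro u
          rw [ENNReal.coe_rpow_of_nonneg _ hq0.le, ENNReal.coe_mul, ENNReal.coe_mul,
            ENNReal.coe_rpow_of_nonneg _ (by positivity), hmμ]
        simp only [hterm]
        rw [ENNReal.coe_mul, ENNReal.coe_rpow_of_nonneg _ (by positivity),
          ENNReal.ofNNReal_finsetSum]
        rfl
      · intro u hu
        rw [hcs u hu]
        simp [hq0]
    have hle := hD fun x => (g x : ℝ≥0∞)
    rw [hQ] at hle
    have hfin := hle.trans_lt (ENNReal.mul_lt_top ENNReal.coe_lt_top ENNReal.coe_lt_top)
    have hI : ((∑ u ∈ s, c u * m u : ℝ≥0) : ℝ≥0∞) ≤ ∫⁻ x in E, g x ∂μ := by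
      rw [setLIntegral_eq_tsum_shell μ hE, ENNReal.ofNNReal_finsetSum]
      refine le_trans (Finset.sum_le_sum fun u _ => ?_) (ENNReal.sum_le_tsum s)
      rw [setLIntegral_congr_fun (g := fun _ => (c u : ℝ≥0∞))
        ((measurableSet_shell _).inter hE), setLIntegral_const, ENNReal.coe_mul, hmμ]
      intro x hx
      simp only [hg, indicator_of_mem hx.2, shellIndex_eq_iff.2 hx.1]
    have hfinal := (hI.trans (h g hgm hfin)).trans (mul_le_mul_right hle (C : ℝ≥0∞))
    rw [← ENNReal.coe_mul, ← ENNReal.coe_mul, ENNReal.coe_le_coe] at hfinal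
    refine hfinal.trans (le_of_eq ?_)
    ring
  refine lt_of_le_of_lt (b := (((C * D * K) ^ q' : ℝ≥0) : ℝ≥0∞)) ?_ ENNReal.coe_lt_top
  rw [ENNReal.tsum_eq_iSup_sum]
  refine iSup_le fun s => ?_
  refine le_trans (le_of_eq ?_) (ENNReal.coe_le_coe.2 (bound s))
  rw [ENNReal.ofNNReal_finsetSum]
  refine Finset.sum_congr rfl fun u _ => ?_
  rw [ENNReal.coe_rpow_of_nonneg _ hq'0.le, ENNReal.coe_mul, ENNReal.coe_inv (hw u),
    ENNReal.coe_rpow_of_nonneg _ (by linarith), hmμ, ENNReal.mul_rpow_of_nonneg _ _ hq'0.le,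
    ← ENNReal.rpow_mul, ENNReal.inv_rpow, ← two_rpow_eq_coe_shellWeight_rpow, ENNReal.rpow_neg]
  congr 2
  rw [Real.conjExponent]
  have : p - 1 ≠ 0 := by linarith
  field_simp

end Characterization

end LorentzHerz

theorem theorem4p8 {𝕜 : Type*} [RCLike 𝕜] {N : ℕ} {Ω : Set (EuclideanSpace ℝ (Fin N))}
    [mΩ : MeasurableSpace Ω] [OpensMeasurableSpace Ω] (μ : Measure Ω) [SigmaFinite μ]
    (a p q r : ℝ) (hp : 1 < p) (hq : 1 < q) (hr : 1 < r) :
    LorentzHerz.IsBanachFunctionSpace μ (LorentzHerz.herzSpace 𝕜 μ a p q r)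
        (LorentzHerz.herzNorm μ a p q r) ↔
      ∀ E : Set Ω, MeasurableSet E → μ E < ∞ →
        (∑' u : Ici (-1 : ℤ), (2 : ℝ≥0∞) ^ (((u : ℤ) : ℝ) * a * q) *
            μ (LorentzHerz.shell Ω u ∩ E) ^ (q / p) < ∞) ∧
        (∑' u : Ici (-1 : ℤ), (2 : ℝ≥0∞) ^ (-(((u : ℤ) : ℝ) * a * q.conjExponent)) *
            μ (LorentzHerz.shell Ω u ∩ E) ^ (q.conjExponent / p.conjExponent) < ∞) := by
  have hp0 : 0 < p := by linarith
  have hq0 : 0 < q := by linarith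
  have hr0 : 0 < r := by linarith
  constructor
  · rintro ⟨η, hη, hX, hν⟩ E hE hEt
    have henorm : ∀ g : Ω → ℝ≥0, (fun x => ‖(((g x : ℝ≥0) : ℝ) : 𝕜)‖ₑ) = fun x => (g x : ℝ≥0∞) := by
      intro g
      ext x
      rw [← ofReal_norm, RCLike.norm_ofReal, abs_of_nonneg (g x).coe_nonneg,
        ENNReal.ofReal_coe_nnreal]
    have hmeas : ∀ g : Ω → ℝ≥0, Measurable g → Measurable fun x => (((g x : ℝ≥0) : ℝ) : 𝕜) :=
      fun g hg => RCLike.measurable_ofReal.comp hg.coe_nnreal_real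
    constructor
    · rw [← LorentzHerz.herzQuasinorm_indicator_one_lt_top_iff hp0 hq0 hr0 hEt]
      set g : Ω → ℝ≥0 := E.indicator 1
      have hg1 : (fun x => (g x : ℝ≥0∞)) = E.indicator 1 := by
        ext x
        by_cases hx : x ∈ E <;> simp [g, hx]
      -- (P4) for `η` places `χ_E` in the space, and membership in the Herz space carries finiteness
      -- of the quasinorm.
      have hmem : (fun x => (((g x : ℝ≥0) : ℝ) : 𝕜)) ∈ LorentzHerz.herzSpace 𝕜 μ a p q r := by
        rw [hX]
        refine ⟨hmeas g (measurable_one.indicator hE), ?_⟩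
        rw [henorm, hg1]
        exact hη.indicator_lt_top E hE hEt
      have h := hmem.2
      rwa [← LorentzHerz.herzQuasinorm_enorm, henorm, hg1] at h
    · obtain ⟨C, -, hC⟩ := hη.setLIntegral_le E hE hEt
      refine LorentzHerz.tsum_conj_lt_top_of_setLIntegral_le hp hq hr hE hEt C fun g hg hfin => ?_
      -- Membership comes from finiteness of the norm; it licenses replacing `herzNorm` by `η`, to
      -- which (P5) applies.
      have hmem : (fun x => (((g x : ℝ≥0) : ℝ) : 𝕜)) ∈ LorentzHerz.herzSpace 𝕜 μ a p q r := by
        rw [LorentzHerz.mem_herzSpace_iff hp hq0 hr, henorm]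
        exact ⟨hmeas g hg, hfin⟩
      have h := hν _ hmem
      rw [← LorentzHerz.herzNorm_enorm, henorm] at h
      rw [h]
      exact hC _ hg.coe_nnreal_ennreal
  · intro h
    refine ⟨LorentzHerz.herzNorm μ a p q r, LorentzHerz.isFunctionNorm_herzNorm hp hq hr
      (fun E hE hEt => (h E hE hEt).1) (fun E hE hEt => (h E hE hEt).2), ?_, ?_⟩
    · ext f
      exact LorentzHerz.mem_herzSpace_iff hp hq0 hr
    · intro f _
      exact (LorentzHerz.herzNorm_enorm f).symm
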